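/- Let $\mathcal{G}$ be a locally compact Hausdorff étale groupoid with compact unit space $\mathcal{G}^{(0)}$. A bisection is a subset $B\subseteq\mathcal{G}$ on which the source map $s$ and the range map $r$ are homeomorphisms onto their images; it defines a homeomorphism $\alpha_B\colon s(B)\to r(B)$, $\alpha_B(x)=r((s|_B)^{-1}(x))$. Let $M(\mathcal{G})$ be the convex set of probability Radon measures $\mu$ on $\mathcal{G}^{(0)}$ that are invariant, i.e. $\mu|_{r(B)}=(\alpha_B)_*(\mu|_{s(B)})$ for every open bisection $B$, with the weak$^*$-topology. Assume that $\mathcal{G}$ is essentially free: for every $\mu\in M(\mathcal{G})$ and every pre-compact open bisection $B\subseteq\mathcal{G}\setminus\mathcal{G}^{(0)}$ one has $\mu(\{x\in s(B):\alpha_B(x)=x\})=0$. Let $\|\cdot\|_\nu$ be a $C^*$-norm on the convolution $*$-algebra $C_c(\mathcal{G})$ that dominates the reduced $C^*$-norm, let $C^*_\nu(\mathcal{G})$ be the completion of $C_c(\mathcal{G})$ in this norm, and let $T(C^*_\nu(\mathcal{G}))$ be the convex set of its tracial states, with the weak$^*$-topology. For $\tau\in T(C^*_\nu(\mathcal{G}))$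 let $\mu_\tau$ be the unique probability Radon measure on $\mathcal{G}^{(0)}$ with $\tau(f)=\int_{\mathcal{G}^{(0)}}f\,d\mu_\tau$ for all $f\in C(\mathcal{G}^{(0)})\subseteq C^*_\nu(\mathcal{G})$. Then $\mu_\tau\in M(\mathcal{G})$, and the map $\tau\mapsto\mu_\tau$ is an affine homeomorphism from $T(C^*_\nu(\mathcal{G}))$ onto $M(\mathcal{G})$. Consequently it identifies the extreme boundaries: $\tau$ is an extreme point of $T(C^*_\nu(\mathcal{G}))$ if and only if $\mu_\tau$ is an extreme point of $M(\mathcal{G})$. In particular, the reduced norm and the maximal norm are $C^*$-norms on $C_c(\mathcal{G})$ for which all of this holds. -/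

import Mathlib

open scoped CompactlySupported ComplexOrder NNReal ENNReal Topology

universe u

/-- The algebraic structure of a groupoid on the set `G` of arrows, with the objects identified with
the identity arrows. The product `mul a b` is only meaningful (and only constrained) for composable
pairs, that is, when `src a = rng b`. -/
class GroupoidStructure (G : Type u) where
  src : G → G
  rng : G → G
  mul : G → G → G
  inv : G → G
  src_src : ∀ a, src (src a) = src a
  rng_src : ∀ a, rng (src a) = src a
  src_rng : ∀ a, src (rng a) = rng a
  rng_rng : ∀ a, rng (rng a) = rng a
  src_mul : ∀ a b, src a = rng b → src (mul a b) = src b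
  rng_mul : ∀ a b, src a = rng b → rng (mul a b) = rng a
  mul_assoc : ∀ a b c, src a = rng b → src b = rng c → mul (mul a b) c = mul a (mul b c)
  mul_src : ∀ a, mul a (src a) = a
  rng_mul_self : ∀ a, mul (rng a) a = a
  src_inv : ∀ a, src (inv a) = rng a
  rng_inv : ∀ a, rng (inv a) = src a
  mul_inv : ∀ a, mul a (inv a) = rng a
  inv_mul : ∀ a, mul (inv a) a = src a

namespace GroupoidStructure

section Algebra

variable {G : Type u} [GroupoidStructure G]

variable (G) in
/-- The set of units (identity arrows). -/
def units : Set G := {a | src a = a}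

variable (G) in
/-- The unit space, with the subspace topology and the restricted Borel structure. -/
abbrev UnitSpace : Type u := units G

/-- The source map onto the unit space. -/
def s (a : G) : UnitSpace G := ⟨src a, src_src a⟩

/-- The range map onto the unit space. -/
def r (a : G) : UnitSpace G := ⟨rng a, src_rng a⟩

/-- The set of arrows with source `x`. -/
abbrev SFiber (x : G) : Type u := {a : G // src a = x}

lemma rng_of_mem_units {a : G} (h : a ∈ units G) : rng a = a := by
  have h' : src a = a := h
  rw [← h', rng_src]

lemma mul_inv_cancel_right' {a b : G} (h : src a = rng b) : mul (mul a b) (inv b) = a := by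
  rw [mul_assoc _ _ _ h (rng_inv b).symm, mul_inv, ← h, mul_src]

lemma inv_mul_cancel_right' {a b : G} (h : src a = src b) : mul (mul a (inv b)) b = a := by
  rw [mul_assoc _ _ _ (by rw [rng_inv, h]) (src_inv b), inv_mul, ← h, mul_src]

lemma inv_inv' (a : G) : inv (inv a) = a := by
  have h := mul_inv (inv a)
  have h2 : mul (mul a (inv a)) (inv (inv a)) = mul a (mul (inv a) (inv (inv a))) :=
    mul_assoc _ _ _ (rng_inv a).symm (rng_inv (inv a)).symm
  rw [mul_inv, mul_inv, rng_inv, mul_src, ← src_inv a, ← rng_inv (inv a), rng_mul_self] at h2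
  exact h2

lemma inv_eq_of_mul_eq {a b : G} (h : src a = rng b) (h' : mul a b = rng a) : inv b = a := by
  have := mul_inv_cancel_right' h
  rw [h', ← src_inv a] at this
  have h3 : src b = rng a := by
    have := src_mul a b h
    rw [h', src_rng] at this
    exact this.symm
  have h4 := rng_mul_self (inv b)
  rw [rng_inv, h3, ← src_inv a] at h4
  rw [← h4, this]

lemma inv_mul' {a b : G} (h : src a = rng b) : inv (mul a b) = mul (inv b) (inv a) := by
  have hc : src (inv b) = rng (inv a) := by rw [src_inv, rng_inv, h]
  apply inv_eq_of_mul_eq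
  · rw [src_mul _ _ hc, src_inv, rng_mul _ _ h]
  · rw [mul_assoc _ _ _ hc (by rw [src_inv, rng_mul _ _ h]), rng_mul _ _ hc,
      ← mul_assoc _ _ _ (src_inv a) h, inv_mul, h, rng_mul_self, inv_mul, rng_inv]

lemma inv_of_mem_units {a : G} (h : a ∈ units G) : inv a = a := by
  have h1 : src a = a := h
  have h2 := rng_of_mem_units h
  have := mul_src (a := a)
  apply inv_eq_of_mul_eq
  · rw [h1, h2]
  · rw [h2]; nth_rewrite 2 [← h1]; exact mul_src a

/-- Right translation by `α`, from the arrows starting at the range of `α`. -/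
def rightMul (α : G) : SFiber (rng α) ≃ SFiber (src α) where
  toFun β := ⟨mul β α, src_mul _ _ β.2⟩
  invFun δ := ⟨mul δ (inv α), by rw [src_mul _ _ (by rw [δ.2, rng_inv]), src_inv]⟩
  left_inv β := Subtype.ext (mul_inv_cancel_right' β.2)
  right_inv δ := Subtype.ext (inv_mul_cancel_right' δ.2)

lemma inv_mul_inv {γ α : G} (h : src γ = src α) : inv (mul γ (inv α)) = mul α (inv γ) := by
  rw [inv_mul' (by rw [rng_inv, h]), inv_inv']

/-- The convolution product of functions on `G`. -/
noncomputable def conv (f g : G → ℂ) (γ : G) : ℂ :=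
  ∑ᶠ α : SFiber (src γ), f (mul γ (inv α)) * g α

/-- The involution on functions on `G`. -/
def involution (f : G → ℂ) (γ : G) : ℂ := star (f (inv γ))

/-- The arrow identity `(γ α⁻¹)(δ α⁻¹)⁻¹ = γ δ⁻¹`. -/
lemma mul_inv_mul_inv {γ α δ : G} (h : src γ = src α) (h' : src δ = src α) :
    mul (mul γ (inv α)) (inv (mul δ (inv α))) = mul γ (inv δ) := by
  have e1 : src γ = rng (inv α) := by rw [rng_inv, h]
  have e2 : src (inv α) = rng (mul α (inv δ)) := by
    rw [src_inv, rng_mul _ _ (by rw [rng_inv, h'])]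
  rw [inv_mul_inv h', mul_assoc _ _ _ e1 e2, ← mul_assoc _ _ _ (src_inv α) (by rw [rng_inv, h']),
    inv_mul, ← h', ← rng_inv δ, rng_mul_self]

lemma conv_eq (f g : G → ℂ) {γ x : G} (hx : src γ = x) :
    conv f g γ = ∑ᶠ α : SFiber x, f (mul γ (inv α)) * g α := by
  subst hx; rfl

lemma conv_translate (f g : G → ℂ) {γ α : G} (h : src γ = src α) :
    conv f g (mul γ (inv α)) =
      ∑ᶠ δ : SFiber (src γ), f (mul γ (inv δ)) * g (mul δ (inv α)) := by
  have hs : src (mul γ (inv α)) = rng α := by rw [src_mul _ _ (by rw [rng_inv, h]), src_inv]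
  rw [conv_eq f g hs, h]
  symm
  rw [← finsum_comp_equiv (rightMul α).symm]
  refine finsum_congr fun δ => ?_
  have e : (((rightMul α).symm δ : SFiber (rng α)) : G) = mul δ.1 (inv α) := rfl
  rw [e, mul_inv_mul_inv h δ.2]

/-- The integrand of the convolution, as a function on pairs of arrows with common source. -/
def convKernel (f g : G → ℂ) (q : {q : G × G // src q.1 = src q.2}) : ℂ :=
  f (mul q.1.1 (inv q.1.2)) * g q.1.2

lemma conv_eq_push (f g : G → ℂ) (γ : G) :
    conv f g γ = ∑ᶠ q ∈ (fun q : {q : G × G // src q.1 = src q.2} => q.1.1) ⁻¹' {γ},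
      convKernel f g q := by
  rw [← finsum_set_coe_eq_finsum_mem]
  refine finsum_eq_of_bijective (fun α => ⟨⟨(γ, α.1), α.2.symm⟩, rfl⟩) ⟨?_, ?_⟩ fun α => rfl
  · intro α β h
    have := congrArg (fun z => z.1.1.2) h
    exact Subtype.ext this
  · rintro ⟨⟨⟨a, b⟩, hab⟩, h⟩
    have h' : a = γ := h
    subst h'
    exact ⟨⟨b, hab.symm⟩, rfl⟩

lemma conv_smul_left (c : ℂ) (f g : G → ℂ) : conv (c • f) g = c • conv f g := by
  funext γ
  simp only [conv, Pi.smul_apply]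
  rw [smul_finsum]
  exact finsum_congr fun α => by simp [_root_.mul_assoc]

lemma conv_smul_right (c : ℂ) (f g : G → ℂ) : conv f (c • g) = c • conv f g := by
  funext γ
  simp only [conv, Pi.smul_apply]
  rw [smul_finsum]
  exact finsum_congr fun α => by simp [mul_left_comm]

lemma involution_involution (f : G → ℂ) : involution (involution f) = f := by
  funext γ
  simp [involution, inv_inv']

lemma involution_conv (f g : G → ℂ) :
    involution (conv f g) = conv (involution g) (involution f) := by
  funext γ
  simp only [involution]
  rw [conv_eq f g (src_inv γ), conv, ← finsum_comp_equiv (rightMul γ).symm]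
  have hm := AddMonoidHom.map_finsum_of_injective (starAddEquiv (R := ℂ)).toAddMonoidHom
    (starAddEquiv (R := ℂ)).injective (fun i : SFiber (src γ) =>
      f (mul (inv γ) (inv ((rightMul γ).symm i : SFiber (rng γ)))) *
        g ((rightMul γ).symm i : SFiber (rng γ)))
  refine hm.trans (finsum_congr fun δ => ?_)
  have e : (((rightMul γ).symm δ : SFiber (rng γ)) : G) = mul δ.1 (inv γ) := rfl
  have e1 : mul (inv γ) (inv (mul δ.1 (inv γ))) = inv δ.1 := by
    rw [← inv_mul' (by rw [src_mul _ _ (by rw [rng_inv, δ.2]), src_inv]),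
      inv_mul_cancel_right' δ.2]
  show star (_ * _) = _
  rw [star_mul, e, e1, involution, involution, inv_mul_inv δ.2.symm]

lemma conv_indicator_left (f g : G → ℂ) :
    conv ((units G).indicator f) g = fun γ => f (rng γ) * g γ := by
  funext γ
  rw [conv, finsum_eq_single _ (⟨γ, rfl⟩ : SFiber (src γ))]
  · rw [mul_inv, Set.indicator_of_mem (show rng γ ∈ units G from src_rng γ)]
  · intro α hα
    rw [Set.indicator_of_notMem, zero_mul]
    intro hu
    apply hα
    have h1 : src (mul γ (inv α)) = mul γ (inv α) := hu
    have h2 := rng_of_mem_units hu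
    have hc : src γ = rng (inv α.1) := by rw [rng_inv, α.2]
    rw [src_mul _ _ hc, src_inv] at h1
    rw [rng_mul _ _ hc] at h2
    have h3 := inv_mul_cancel_right' (a := γ) (b := α) α.2.symm
    rw [← h1, rng_mul_self] at h3
    exact Subtype.ext h3

lemma conv_indicator_right (f g : G → ℂ) :
    conv g ((units G).indicator f) = fun γ => g γ * f (src γ) := by
  funext γ
  rw [conv, finsum_eq_single _ (⟨src γ, src_src γ⟩ : SFiber (src γ))]
  · have hu : src γ ∈ units G := src_src γ
    show g (mul γ (inv (src γ))) * _ = _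
    rw [inv_of_mem_units hu, mul_src, Set.indicator_of_mem hu]
  · intro α hα
    rw [Set.indicator_of_notMem, mul_zero]
    intro hu
    exact hα (Subtype.ext ((show src α.1 = α.1 from hu).symm.trans α.2))

end Algebra

end GroupoidStructure

open GroupoidStructure

/-- An étale topological groupoid: the structure maps are continuous (the product on the subspace of
composable pairs), and the range map onto the unit space is a local homeomorphism. -/
class EtaleGroupoid (G : Type u) [TopologicalSpace G] [GroupoidStructure G] : Prop where
  continuous_src : Continuous (src : G → G)
  continuous_rng : Continuous (rng : G → G)
  continuous_inv : Continuous (inv : G → G)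
  continuous_mul : Continuous fun p : {p : G × G // src p.1 = rng p.2} => mul p.1.1 p.1.2
  isLocalHomeomorph_r : IsLocalHomeomorph (r : G → UnitSpace G)

/-! ### The completion of a normed `*`-algebra with the `C*`-identity -/

section CStarCompletion

variable {A : Type u} [NormedRing A] [StarRing A]

noncomputable instance instStarCompletion : Star (UniformSpace.Completion A) :=
  ⟨UniformSpace.Completion.map star⟩

lemma completion_continuous_star :
    Continuous (star : UniformSpace.Completion A → UniformSpace.Completion A) :=
  UniformSpace.Completion.continuous_map

variable [CStarRing A]

lemma uniformContinuous_star_of_cstar : UniformContinuous (star : A → A) :=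
  (star_isometry (E := A)).uniformContinuous

lemma completion_coe_star (a : A) :
    ((star a : A) : UniformSpace.Completion A) = star (a : UniformSpace.Completion A) :=
  (UniformSpace.Completion.map_coe uniformContinuous_star_of_cstar a).symm

/-- The completion of a normed `*`-algebra satisfying the `C*`-identity is a `C*`-algebra. -/
noncomputable instance instCStarAlgebraCompletion [NormedAlgebra ℂ A] [StarModule ℂ A] :
    CStarAlgebra (UniformSpace.Completion A) where
  star_involutive a := by
    refine UniformSpace.Completion.induction_on a ?_ fun a => ?_
    · exact isClosed_eq (completion_continuous_star.comp completion_continuous_star) continuous_id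
    · rw [← completion_coe_star, ← completion_coe_star, star_star]
  star_mul a b := by
    refine UniformSpace.Completion.induction_on₂ a b ?_ fun a b => ?_
    · exact isClosed_eq (completion_continuous_star.comp continuous_mul)
        ((completion_continuous_star.comp continuous_snd).mul
          (completion_continuous_star.comp continuous_fst))
    · rw [← UniformSpace.Completion.coe_mul, ← completion_coe_star, star_mul,
        UniformSpace.Completion.coe_mul, completion_coe_star, completion_coe_star]
  star_add a b := by
    refine UniformSpace.Completion.induction_on₂ a b ?_ fun a b => ?_
    · exact isClosed_eq (completion_continuous_star.comp continuous_add)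
        ((completion_continuous_star.comp continuous_fst).add
          (completion_continuous_star.comp continuous_snd))
    · rw [← UniformSpace.Completion.coe_add, ← completion_coe_star, star_add,
        UniformSpace.Completion.coe_add, completion_coe_star, completion_coe_star]
  norm_mul_self_le a := by
    refine UniformSpace.Completion.induction_on a ?_ fun a => ?_
    · exact isClosed_le (continuous_norm.mul continuous_norm)
        ((completion_continuous_star.mul continuous_id).norm)
    · rw [← completion_coe_star, ← UniformSpace.Completion.coe_mul,
        UniformSpace.Completion.norm_coe, UniformSpace.Completion.norm_coe]
      exact CStarRing.norm_mul_self_le a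
  norm_smul_le c a := norm_smul_le c a
  star_smul c a := by
    refine UniformSpace.Completion.induction_on a ?_ fun a => ?_
    · exact isClosed_eq (completion_continuous_star.comp (continuous_const_smul c))
        ((completion_continuous_star).const_smul (star c))
    · rw [← UniformSpace.Completion.coe_smul, ← completion_coe_star, star_smul,
        UniformSpace.Completion.coe_smul, completion_coe_star]

end CStarCompletion

/-- The set of tracial states of a unital `C*`-algebra, with the weak-`*` topology on the
surrounding dual space: positive unital functionals `τ` with `τ (a b) = τ (b a)`. -/
def tracialStates (A : Type*) [CStarAlgebra A] : Set (WeakDual ℂ A) :=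
  {τ | (∀ a, 0 ≤ τ (star a * a)) ∧ τ 1 = 1 ∧ ∀ a b, τ (a * b) = τ (b * a)}

namespace GroupoidStructure

/-! ### Summation over the fibres of a local homeomorphism -/

section Push

variable {E B : Type*} [TopologicalSpace E] [TopologicalSpace B] [T2Space B]
  {p : E → B} {h : E → ℂ}

lemma finite_fiber_inter (hp : IsLocalHomeomorph p) {K : Set E} (hK : IsCompact K) (b : B) :
    (p ⁻¹' {b} ∩ K).Finite := by
  have hc : IsCompact (p ⁻¹' {b} ∩ K) :=
    hK.inter_left ((isClosed_singleton).preimage hp.continuous)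
  choose U hU using fun e => hp e
  obtain ⟨t, -, ht⟩ := hc.elim_nhds_subcover (fun e => (U e).source)
    (fun e _ => (U e).open_source.mem_nhds (hU e).1)
  refine (Set.Finite.biUnion t.finite_toSet (t := fun e => p ⁻¹' {b} ∩ (U e).source) ?_).subset ?_
  · intro e _
    apply Set.Subsingleton.finite
    rintro x ⟨hx, hx'⟩ y ⟨hy, hy'⟩
    apply (U e).injOn hx' hy'
    rw [← (hU e).2]; exact hx.trans hy.symm
  · intro x hx
    have := ht hx
    simp only [Set.mem_iUnion] at this ⊢
    obtain ⟨e, he, h'⟩ := this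
    exact ⟨e, he, hx.1, h'⟩

lemma continuous_push [T2Space E] (hp : IsLocalHomeomorph p) (hc : Continuous h)
    (hs : HasCompactSupport h) : Continuous fun b => ∑ᶠ e ∈ p ⁻¹' {b}, h e := by
  classical
  rw [continuous_iff_continuousAt]
  intro b
  have hfin := finite_fiber_inter hp hs b
  obtain ⟨V, hV, hVd⟩ := hfin.t2_separation
  choose U hU using fun e => hp e
  let φ : E → OpenPartialHomeomorph E B := fun e => (U e).restrOpen (V e) (hV e).2
  have hφs : ∀ e, (φ e).source = (U e).source ∩ V e := fun e => (U e).restrOpen_source _ _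
  have hφ : ∀ e x, φ e x = p x := fun e x => by rw [(hU e).2]; rfl
  have hes : ∀ e, e ∈ (φ e).source := fun e => by rw [hφs]; exact ⟨(hU e).1, (hV e).1⟩
  set F := hfin.toFinset with hF
  have hFp : ∀ e ∈ F, p e = b := fun e he => ((hfin.mem_toFinset).1 he).1
  have hbt : ∀ e ∈ F, b ∈ (φ e).target := fun e he => by
    rw [← hFp e he, ← hφ e]; exact (φ e).map_source (hes e)
  let K' : Set E := tsupport h \ ⋃ e ∈ F, (φ e).source
  have hK' : IsCompact K' := hs.diff (isOpen_biUnion fun e _ => (φ e).open_source)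
  have hbK : b ∉ p '' K' := by
    rintro ⟨e, he, rfl⟩
    apply he.2
    simp only [Set.mem_iUnion]
    exact ⟨e, (hfin.mem_toFinset).2 ⟨rfl, he.1⟩, hes e⟩
  have ev1 : ∀ᶠ x in 𝓝 b, x ∉ p '' K' :=
    (hK'.image hp.continuous).isClosed.isOpen_compl.mem_nhds hbK
  have ev2 : ∀ᶠ x in 𝓝 b, ∀ e ∈ F, x ∈ (φ e).target :=
    (Filter.eventually_all_finset F).2 fun e he => (φ e).open_target.mem_nhds (hbt e he)
  have key : ∀ᶠ x in 𝓝 b, ∑ e ∈ F, h ((φ e).symm x) = ∑ᶠ e ∈ p ⁻¹' {x}, h e := by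
    filter_upwards [ev1, ev2] with x hx1 hx2
    have hinj : Set.InjOn (fun e => (φ e).symm x) F := by
      intro e he e' he' hee
      by_contra hne
      have h1 := (φ e).map_target (hx2 e he)
      have h2 := (φ e').map_target (hx2 e' he')
      simp only at hee
      rw [← hee] at h2
      rw [hφs] at h1 h2
      exact Set.disjoint_left.1 (hVd ((hfin.mem_toFinset).1 he) ((hfin.mem_toFinset).1 he') hne)
        h1.2 h2.2
    rw [← Finset.sum_image (f := h) hinj]
    symm
    apply finsum_mem_eq_sum_of_inter_support_eq
    ext y
    simp only [Set.mem_inter_iff, Set.mem_preimage, Set.mem_singleton_iff, Finset.coe_image,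
      Set.mem_image, Finset.mem_coe]
    refine and_congr_left fun hy => ⟨fun hyx => ?_, ?_⟩
    · by_cases hyK : y ∈ K'
      · exact absurd ⟨y, hyK, hyx⟩ hx1
      · have : y ∈ ⋃ e ∈ F, (φ e).source := by
          by_contra hcon
          exact hyK ⟨subset_tsupport h hy, hcon⟩
        simp only [Set.mem_iUnion] at this
        obtain ⟨e, he, hye⟩ := this
        refine ⟨e, he, ?_⟩
        rw [← hyx, ← hφ e]; exact (φ e).left_inv hye
    · rintro ⟨e, he, rfl⟩
      rw [← hφ e]; exact (φ e).right_inv (hx2 e he)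
  refine ContinuousAt.congr ?_ key
  refine tendsto_finsetSum _ fun e he => ?_
  exact (hc.continuousAt).comp ((φ e).continuousAt_symm (hbt e he))

lemma hasCompactSupport_push (hp : IsLocalHomeomorph p)
    (hs : HasCompactSupport h) : HasCompactSupport fun b => ∑ᶠ e ∈ p ⁻¹' {b}, h e := by
  refine HasCompactSupport.intro (hs.image hp.continuous) fun x hx => ?_
  apply finsum_mem_eq_zero_of_forall_eq_zero
  intro e he
  by_contra hne
  exact hx ⟨e, subset_tsupport h hne, he⟩

end Push

/-! ### The convolution algebra of continuous compactly supported functions -/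

section Top

variable {G : Type u} [TopologicalSpace G] [GroupoidStructure G] [EtaleGroupoid G]

lemma continuous_s : Continuous (s : G → UnitSpace G) :=
  EtaleGroupoid.continuous_src.subtype_mk _

lemma continuous_r : Continuous (r : G → UnitSpace G) :=
  EtaleGroupoid.continuous_rng.subtype_mk _

variable (G) in
/-- Inversion as a homeomorphism. -/
def invHomeo : G ≃ₜ G where
  toFun := inv
  invFun := inv
  left_inv := inv_inv'
  right_inv := inv_inv'
  continuous_toFun := EtaleGroupoid.continuous_inv
  continuous_invFun := EtaleGroupoid.continuous_inv

lemma isLocalHomeomorph_s : IsLocalHomeomorph (s : G → UnitSpace G) := by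
  have : (s : G → UnitSpace G) = r ∘ invHomeo G := by
    funext a; exact Subtype.ext (rng_inv a).symm
  rw [this]
  exact EtaleGroupoid.isLocalHomeomorph_r.comp (invHomeo G).isLocalHomeomorph

lemma isOpen_units : IsOpen (units G) := by
  rw [isOpen_iff_mem_nhds]
  intro x hx
  obtain ⟨e, hxe, he⟩ := EtaleGroupoid.isLocalHomeomorph_r x
  have hr : rng x = x := rng_of_mem_units hx
  have h1 : e.source ∈ 𝓝 x := e.open_source.mem_nhds hxe
  have h2 : rng ⁻¹' e.source ∈ 𝓝 x :=
    (e.open_source.preimage EtaleGroupoid.continuous_rng).mem_nhds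
      (show rng x ∈ e.source by rw [hr]; exact hxe)
  filter_upwards [h1, h2] with y hy1 hy2
  have : rng y = y := by
    apply e.injOn hy2 hy1
    rw [← he]; exact Subtype.ext (rng_rng y)
  show src y = y
  rw [← this, src_rng]

/-- The pull-back of the source map along itself. -/
lemma isLocalHomeomorph_fst :
    IsLocalHomeomorph fun q : {q : G × G // src q.1 = src q.2} => q.1.1 := by
  have hcont : Continuous fun q : {q : G × G // src q.1 = src q.2} => q.1.1 :=
    continuous_fst.comp continuous_subtype_val
  have hopen : IsOpenMap fun q : {q : G × G // src q.1 = src q.2} => q.1.1 := by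
    refine IsOpenMap.of_nhds_le fun q => ?_
    obtain ⟨⟨γ, α⟩, hq⟩ := q
    intro W hW
    rw [Filter.mem_map, nhds_subtype_eq_comap, Filter.mem_comap] at hW
    obtain ⟨W', hW', hsub⟩ := hW
    obtain ⟨e, hαe, he⟩ := isLocalHomeomorph_s α
    have hsα : s γ = e α := by rw [← he]; exact Subtype.ext hq
    have hmem : s γ ∈ e.target := by rw [hsα]; exact e.map_source hαe
    have hσ : ContinuousAt (fun γ' : G => (γ', e.symm (s γ'))) γ :=
      continuousAt_id.prodMk ((e.continuousAt_symm hmem).comp continuous_s.continuousAt)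
    have hσv : (γ, e.symm (s γ)) = (γ, α) := by rw [hsα, e.left_inv hαe]
    have h1 : ∀ᶠ γ' in 𝓝 γ, (γ', e.symm (s γ')) ∈ W' := by
      apply hσ
      simp only [hσv]
      exact hW'
    have h2 : ∀ᶠ γ' in 𝓝 γ, s γ' ∈ e.target :=
      continuous_s.continuousAt (e.open_target.mem_nhds hmem)
    filter_upwards [h1, h2] with γ' h1 h2
    have hc : src γ' = src (e.symm (s γ')) := by
      have := e.right_inv h2
      rw [← he] at this
      exact (congrArg Subtype.val this).symm
    exact hsub (a := ⟨(γ', e.symm (s γ')), hc⟩) h1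
  rw [isLocalHomeomorph_iff_isOpenEmbedding_restrict]
  intro q
  obtain ⟨e, hαe, he⟩ := isLocalHomeomorph_s q.1.2
  have hUo : IsOpen {z : {q : G × G // src q.1 = src q.2} | z.1.2 ∈ e.source} :=
    e.open_source.preimage (continuous_snd.comp continuous_subtype_val)
  refine ⟨{z | z.1.2 ∈ e.source}, hUo.mem_nhds hαe, ?_⟩
  refine .of_continuous_injective_isOpenMap (hcont.comp continuous_subtype_val) ?_
    (hopen.domRestrict hUo)
  rintro ⟨⟨⟨a, b⟩, hab⟩, hb⟩ ⟨⟨⟨a', b'⟩, hab'⟩, hb'⟩ heq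
  have h1 : a = a' := heq
  subst h1
  have h2 : b = b' := by
    apply e.injOn hb hb'
    rw [← he]
    exact Subtype.ext (hab.symm.trans hab')
  subst h2
  rfl

lemma continuous_convKernel {f g : G → ℂ} (hf : Continuous f) (hg : Continuous g) :
    Continuous (convKernel f g) := by
  have h1 : Continuous fun q : {q : G × G // src q.1 = src q.2} => mul q.1.1 (inv q.1.2) := by
    have h2 : Continuous fun q : {q : G × G // src q.1 = src q.2} =>
        (⟨(q.1.1, inv q.1.2), by rw [rng_inv]; exact q.2⟩ : {p : G × G // src p.1 = rng p.2}) :=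
      (((continuous_fst.comp continuous_subtype_val).prodMk
        (EtaleGroupoid.continuous_inv.comp
          (continuous_snd.comp continuous_subtype_val)))).subtype_mk _
    exact EtaleGroupoid.continuous_mul.comp h2
  exact (hf.comp h1).mul (hg.comp (continuous_snd.comp continuous_subtype_val))

variable [T2Space G]

lemma isClosed_units : IsClosed (units G) :=
  isClosed_eq EtaleGroupoid.continuous_src continuous_id

lemma isClopen_units : IsClopen (units G) := ⟨isClosed_units, isOpen_units⟩

lemma finite_fiber (x : G) {f : G → ℂ} (hf : HasCompactSupport f) :
    (Function.support fun α : SFiber x => f α).Finite := by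
  by_cases hx : x ∈ units G
  · have := (finite_fiber_inter (isLocalHomeomorph_s (G := G)) hf ⟨x, hx⟩)
    refine Set.Finite.of_finite_image (f := Subtype.val) (this.subset ?_)
      Subtype.val_injective.injOn
    rintro _ ⟨α, hα, rfl⟩
    exact ⟨Subtype.ext α.2, subset_tsupport f hα⟩
  · have : IsEmpty (SFiber x) := ⟨fun α => hx (by
      show src x = x
      rw [← α.2, src_src])⟩
    exact Set.toFinite _


section Conv

variable {f g : G → ℂ}

lemma hasCompactSupport_convKernel (hf : HasCompactSupport f) (hg : HasCompactSupport g) :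
    HasCompactSupport (convKernel f g) := by
  have hcl : Topology.IsClosedEmbedding
      (Subtype.val : {p : G × G // src p.1 = rng p.2} → G × G) :=
    (isClosed_eq (EtaleGroupoid.continuous_src.comp continuous_fst)
      (EtaleGroupoid.continuous_rng.comp continuous_snd)).isClosedEmbedding_subtypeVal
  have hK := hcl.isCompact_preimage (hf.prod hg)
  have hΨ : Continuous fun p : {p : G × G // src p.1 = rng p.2} =>
      (⟨(mul p.1.1 p.1.2, p.1.2), src_mul _ _ p.2⟩ : {q : G × G // src q.1 = src q.2}) :=
    (EtaleGroupoid.continuous_mul.prodMk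
      (continuous_snd.comp continuous_subtype_val)).subtype_mk _
  refine HasCompactSupport.intro (hK.image hΨ) fun q hq => ?_
  by_contra hne
  apply hq
  refine ⟨⟨(mul q.1.1 (inv q.1.2), q.1.2), ?_⟩, ⟨?_, ?_⟩, ?_⟩
  · rw [src_mul _ _ (by rw [rng_inv]; exact q.2), src_inv]
  · exact subset_tsupport f (left_ne_zero_of_mul hne)
  · exact subset_tsupport g (right_ne_zero_of_mul hne)
  · exact Subtype.ext (Prod.ext (inv_mul_cancel_right' q.2) rfl)

lemma continuous_conv (hf : Continuous f) (hg : Continuous g) (hf' : HasCompactSupport f)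
    (hg' : HasCompactSupport g) : Continuous (conv f g) := by
  have : conv f g = _ := funext (conv_eq_push f g)
  rw [this]
  exact continuous_push isLocalHomeomorph_fst (continuous_convKernel hf hg)
    (hasCompactSupport_convKernel hf' hg')

lemma hasCompactSupport_conv (hf' : HasCompactSupport f)
    (hg' : HasCompactSupport g) : HasCompactSupport (conv f g) := by
  have : conv f g = _ := funext (conv_eq_push f g)
  rw [this]
  exact hasCompactSupport_push isLocalHomeomorph_fst (hasCompactSupport_convKernel hf' hg')

lemma finite_fiber_left (γ : G) (hf : HasCompactSupport f) :
    (Function.support fun α : SFiber (src γ) => f (mul γ (inv α))).Finite := by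
  have hfin := finite_fiber (rng γ) (hf.comp_homeomorph (invHomeo G))
  refine (hfin.preimage (rightMul γ).symm.injective.injOn).subset fun α hα => ?_
  have e : inv (((rightMul γ).symm α : SFiber (rng γ)) : G) = mul γ (inv α) :=
    inv_mul_inv (γ := α.1) (α := γ) α.2
  show f (inv (((rightMul γ).symm α : SFiber (rng γ)) : G)) ≠ 0
  rw [e]
  exact hα

lemma conv_assoc {h : G → ℂ} (hf : HasCompactSupport f) (hh : HasCompactSupport h) :
    conv (conv f g) h = conv f (conv g h) := by
  funext γ
  have hS := finite_fiber_left γ hf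
  have hT := finite_fiber (src γ) hh
  have e1 : conv (conv f g) h γ =
      ∑ α ∈ hT.toFinset, (∑ δ ∈ hS.toFinset, f (mul γ (inv δ)) * g (mul δ (inv α))) * h α := by
    rw [conv, finsum_eq_sum_of_support_subset (s := hT.toFinset)]
    · refine Finset.sum_congr rfl fun α _ => ?_
      rw [conv_translate f g α.2.symm, finsum_eq_sum_of_support_subset (s := hS.toFinset)]
      intro δ hδ
      simpa using left_ne_zero_of_mul hδ
    · intro α hα
      simpa using right_ne_zero_of_mul hα
  have e2 : conv f (conv g h) γ =
      ∑ δ ∈ hS.toFinset, f (mul γ (inv δ)) * ∑ α ∈ hT.toFinset, g (mul δ (inv α)) * h α := by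
    rw [conv, finsum_eq_sum_of_support_subset (s := hS.toFinset)]
    · refine Finset.sum_congr rfl fun δ _ => ?_
      rw [conv_eq g h δ.2, finsum_eq_sum_of_support_subset (s := hT.toFinset)]
      intro α hα
      simpa using right_ne_zero_of_mul hα
    · intro δ hδ
      simpa using left_ne_zero_of_mul hδ
  rw [e1, e2]
  simp_rw [Finset.sum_mul, Finset.mul_sum, _root_.mul_assoc]
  exact Finset.sum_comm

lemma conv_add_left (f' : G → ℂ) (hg : HasCompactSupport g) :
    conv (f + f') g = conv f g + conv f' g := by
  funext γ
  have hT := finite_fiber (src γ) hg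
  simp only [conv, Pi.add_apply]
  rw [← finsum_add_distrib]
  · exact finsum_congr fun α => by ring
  · exact hT.subset fun α hα => right_ne_zero_of_mul hα
  · exact hT.subset fun α hα => right_ne_zero_of_mul hα

lemma conv_add_right {g' : G → ℂ} (hg : HasCompactSupport g) (hg' : HasCompactSupport g') :
    conv f (g + g') = conv f g + conv f g' := by
  funext γ
  simp only [conv, Pi.add_apply]
  rw [← finsum_add_distrib]
  · exact finsum_congr fun α => by ring
  · exact (finite_fiber (src γ) hg).subset fun α hα => right_ne_zero_of_mul hα
  · exact (finite_fiber (src γ) hg').subset fun α hα => right_ne_zero_of_mul hα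

end Conv

end Top

section Cc

/-- The complex vector space of continuous compactly supported functions on `G`, to be
equipped with the convolution product (and not with the pointwise one). -/
def Cc (G : Type u) [TopologicalSpace G] : Type u := C_c(G, ℂ)

variable {G : Type u} [TopologicalSpace G]

namespace Cc

instance : FunLike (Cc G) G ℂ := inferInstanceAs (FunLike C_c(G, ℂ) G ℂ)

noncomputable instance : AddCommGroup (Cc G) := inferInstanceAs (AddCommGroup C_c(G, ℂ))

noncomputable instance : Module ℂ (Cc G) := inferInstanceAs (Module ℂ C_c(G, ℂ))

lemma continuous (f : Cc G) : Continuous f := ContinuousMap.continuous (CompactlySupportedContinuousMap.toContinuousMap f)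

lemma hasCompactSupport (f : Cc G) : HasCompactSupport f :=
  CompactlySupportedContinuousMap.hasCompactSupport' f

/-- Constructor from a function. -/
def of (f : G → ℂ) (h : Continuous f) (h' : HasCompactSupport f) : Cc G :=
  (⟨⟨f, h⟩, h'⟩ : C_c(G, ℂ))

@[simp] lemma coe_of (f : G → ℂ) (h : Continuous f) (h' : HasCompactSupport f) :
    ⇑(of f h h') = f := rfl

lemma coe_inj {f g : Cc G} (h : (f : G → ℂ) = g) : f = g := DFunLike.coe_injective h

@[simp] lemma coe_add (f g : Cc G) : ⇑(f + g) = f + g := rfl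
@[simp] lemma coe_zero : ⇑(0 : Cc G) = 0 := rfl
@[simp] lemma coe_smul (c : ℂ) (f : Cc G) : ⇑(c • f) = c • ⇑f := rfl

variable [GroupoidStructure G] [EtaleGroupoid G]

/-- The involution `f* (γ) = conj (f (γ⁻¹))`. -/
noncomputable instance : Star (Cc G) where
  star f := of (involution f) (f.continuous.comp EtaleGroupoid.continuous_inv).star
    ((f.hasCompactSupport.comp_homeomorph (invHomeo G)).comp_left (star_zero ℂ))

@[simp] lemma coe_star (f : Cc G) : ⇑(star f) = involution f := rfl

variable [T2Space G]

/-- The convolution product. -/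
noncomputable instance : Mul (Cc G) where
  mul f g := of (conv f g)
    (continuous_conv f.continuous g.continuous f.hasCompactSupport g.hasCompactSupport)
    (hasCompactSupport_conv f.hasCompactSupport g.hasCompactSupport)

@[simp] lemma coe_mul (f g : Cc G) : ⇑(f * g) = conv f g := rfl

noncomputable instance : NonUnitalRing (Cc G) where
  mul_assoc f g h := coe_inj (conv_assoc f.hasCompactSupport h.hasCompactSupport)
  left_distrib f _ _ := coe_inj (conv_add_right (f := f) (hasCompactSupport _)
    (hasCompactSupport _))
  right_distrib _ _ h := coe_inj (conv_add_left _ h.hasCompactSupport)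
  zero_mul _ := coe_inj (funext fun γ => by simp [conv])
  mul_zero _ := coe_inj (funext fun γ => by simp [conv])

noncomputable instance : StarRing (Cc G) where
  star_involutive f := coe_inj (involution_involution f)
  star_mul f g := coe_inj (involution_conv f g)
  star_add f g := coe_inj (funext fun γ => by simp [involution])

instance : IsScalarTower ℂ (Cc G) (Cc G) :=
  ⟨fun c f g => coe_inj (conv_smul_left c f g)⟩

instance : SMulCommClass ℂ (Cc G) (Cc G) :=
  ⟨fun c f g => coe_inj (conv_smul_right c f g).symm⟩

instance : StarModule ℂ (Cc G) :=
  ⟨fun c f => coe_inj (funext fun γ => by simp [involution])⟩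

section Unital

variable [CompactSpace (UnitSpace G)]

/-- The inclusion of the functions on the (compact) unit space into `C_c(G)`: the function `f`
is extended by zero outside of the units. -/
noncomputable def inclusion (f : C(UnitSpace G, ℂ)) : Cc G :=
  of ((units G).indicator fun γ => f (s γ))
    ((f.continuous.comp continuous_s).indicator (by simp [isClopen_units.frontier_eq]))
    (HasCompactSupport.intro (isCompact_iff_compactSpace.2 inferInstance : IsCompact (units G))
      fun _ h => Set.indicator_of_notMem h _)

noncomputable instance : One (Cc G) := ⟨inclusion 1⟩

lemma coe_one : ⇑(1 : Cc G) = (units G).indicator fun _ => 1 := rfl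

noncomputable instance : Ring (Cc G) where
  __ := (inferInstance : NonUnitalRing (Cc G))
  one_mul f := coe_inj (by rw [coe_mul, coe_one, conv_indicator_left]; simp)
  mul_one f := coe_inj (by rw [coe_mul, coe_one, conv_indicator_right]; simp)

noncomputable instance : Algebra ℂ (Cc G) :=
  Algebra.ofModule (fun c f g => smul_mul_assoc c f g) (fun c f g => mul_smul_comm c f g)

end Unital

end Cc

/-! ### The reduced and the maximal norm -/

section Norms

variable [GroupoidStructure G] [EtaleGroupoid G]

/-- The sum of `|f|` over the arrows with source `x`. -/
noncomputable def fiberSum (f : Cc G) (x : UnitSpace G) : ℝ := ∑ᶠ γ : SFiber (x : G), ‖f γ‖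

/-- The `I`-norm on `C_c(G)`. -/
noncomputable def iNorm (f : Cc G) : ℝ :=
  max (⨆ x : UnitSpace G, fiberSum f x) (⨆ x : UnitSpace G, fiberSum (star f) x)

lemma iNorm_nonneg (f : Cc G) : 0 ≤ iNorm f := by
  refine le_max_of_le_left (Real.iSup_nonneg fun x => ?_)
  exact finsum_nonneg fun _ => norm_nonneg _

variable [T2Space G]

lemma bddAbove_fiberSum (f : Cc G) : BddAbove (Set.range (fiberSum f)) := by
  let h : G → ℂ := fun γ => (‖f γ‖ : ℂ)
  have hc : Continuous h := Complex.continuous_ofReal.comp f.continuous.norm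
  have hs : HasCompactSupport h := f.hasCompactSupport.comp_left (g := fun z : ℂ => (‖z‖ : ℂ))
    (by simp)
  obtain ⟨C, hC⟩ := (continuous_push isLocalHomeomorph_s hc hs).bounded_above_of_compact_support
    (hasCompactSupport_push isLocalHomeomorph_s hs)
  refine ⟨C, ?_⟩
  rintro _ ⟨x, rfl⟩
  have hx : (∑ᶠ e ∈ (s : G → UnitSpace G) ⁻¹' {x}, h e) = (fiberSum f x : ℂ) := by
    rw [← finsum_set_coe_eq_finsum_mem]
    have h1 := AddMonoidHom.map_finsum_of_injective (Complex.ofRealHom : ℝ →+* ℂ).toAddMonoidHom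
      Complex.ofReal_injective (fun γ : SFiber (x : G) => ‖f γ‖)
    refine Eq.trans ?_ h1.symm
    refine finsum_eq_of_bijective (fun e => ⟨e.1, congrArg Subtype.val e.2⟩) ⟨?_, ?_⟩ fun e => rfl
    · intro a b hab
      exact Subtype.ext (congrArg (fun z => z.1) hab)
    · intro a
      exact ⟨⟨a.1, Subtype.ext a.2⟩, rfl⟩
  have := hC x
  rw [hx] at this
  exact (le_abs_self _).trans (by simpa using this)

lemma fiberSum_le (f : Cc G) (x : UnitSpace G) : fiberSum f x ≤ iNorm f :=
  (le_ciSup (bddAbove_fiberSum f) x).trans (le_max_left _ _)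

lemma fiberSum_star_le (f : Cc G) (x : UnitSpace G) : fiberSum (star f) x ≤ iNorm f :=
  (le_ciSup (bddAbove_fiberSum (star f)) x).trans (le_max_right _ _)

lemma sum_le_fiberSum (f : Cc G) (x : UnitSpace G) {ι : Type*} (T : Finset ι)
    (φ : ι → SFiber (x : G)) (hφ : Function.Injective φ) :
    ∑ i ∈ T, ‖f (φ i)‖ ≤ fiberSum f x := by
  have hfin : (Function.support fun γ : SFiber (x : G) => ‖f γ‖).Finite :=
    (finite_fiber (x : G) f.hasCompactSupport).subset fun γ h => by simpa using h
  rw [fiberSum, ← tsum_eq_finsum (L := .unconditional _) hfin]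
  have hsum : Summable fun γ : SFiber (x : G) => ‖f γ‖ := summable_of_hasFiniteSupport hfin
  have := hsum.sum_le_tsum (T.map ⟨φ, hφ⟩) (fun _ _ => norm_nonneg _)
  rwa [Finset.sum_map] at this

lemma column_le (f : Cc G) {x : G} (S : Finset (SFiber x)) (α : SFiber x) :
    ∑ γ ∈ S, ‖f (mul γ.1 (inv α.1))‖ ≤ iNorm f := by
  obtain ⟨α, rfl⟩ := α
  exact (sum_le_fiberSum f (r α) S (rightMul α).symm (rightMul α).symm.injective).trans
    (fiberSum_le f _)

lemma row_le (f : Cc G) {x : G} (T : Finset (SFiber x)) (γ : SFiber x) :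
    ∑ α ∈ T, ‖f (mul γ.1 (inv α.1))‖ ≤ iNorm f := by
  obtain ⟨γ, rfl⟩ := γ
  refine le_trans (le_of_eq (Finset.sum_congr rfl fun α _ => ?_))
    ((sum_le_fiberSum (star f) (r γ) T (rightMul γ).symm (rightMul γ).symm.injective).trans
      (fiberSum_star_le f _))
  have e : (((rightMul γ).symm α : SFiber (rng γ)) : G) = mul α.1 (inv γ) := rfl
  rw [e, Cc.coe_star, involution, norm_star, inv_mul_inv α.2]

/-- The formula for the left regular representation: `(λ_x(f) ξ)(γ) = ∑ f(γ α⁻¹) ξ(α)`. -/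
noncomputable def regFun (f : Cc G) {x : G} (ξ : SFiber x → ℂ) (γ : SFiber x) : ℂ :=
  ∑ᶠ α : SFiber x, f (mul γ.1 (inv α.1)) * ξ α

lemma finite_row (f : Cc G) {x : G} (γ : SFiber x) :
    (Function.support fun α : SFiber x => f (mul γ.1 (inv α.1))).Finite := by
  obtain ⟨γ, rfl⟩ := γ
  exact finite_fiber_left γ f.hasCompactSupport

lemma regFun_eq_sum (f : Cc G) {x : G} (ξ : SFiber x → ℂ) (γ : SFiber x) {T : Finset (SFiber x)}
    (hT : (finite_row f γ).toFinset ⊆ T) :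
    regFun f ξ γ = ∑ α ∈ T, f (mul γ.1 (inv α.1)) * ξ α := by
  refine finsum_eq_sum_of_support_subset _ fun α hα => hT ?_
  simpa using left_ne_zero_of_mul hα

lemma sum_regFun_le (f : Cc G) {x : G} (ξ : lp (fun _ : SFiber x => ℂ) 2)
    (S : Finset (SFiber x)) :
    ∑ γ ∈ S, ‖regFun f ξ γ‖ ^ 2 ≤ (iNorm f * ‖ξ‖) ^ 2 := by
  classical
  set T : Finset (SFiber x) := S.biUnion fun γ => (finite_row f γ).toFinset
  have hI := iNorm_nonneg f
  have h1 : ∀ γ ∈ S, ‖regFun f ξ γ‖ ^ 2 ≤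
      iNorm f * ∑ α ∈ T, ‖f (mul γ.1 (inv α.1))‖ * ‖ξ α‖ ^ 2 := by
    intro γ hγ
    rw [regFun_eq_sum f ξ γ (Finset.subset_biUnion_of_mem (fun γ => (finite_row f γ).toFinset) hγ)]
    calc ‖∑ α ∈ T, f (mul γ.1 (inv α.1)) * ξ α‖ ^ 2
        ≤ (∑ α ∈ T, ‖f (mul γ.1 (inv α.1))‖ * ‖ξ α‖) ^ 2 := by
          gcongr
          exact (norm_sum_le _ _).trans (le_of_eq (Finset.sum_congr rfl fun α _ => norm_mul _ _))
      _ ≤ (∑ α ∈ T, ‖f (mul γ.1 (inv α.1))‖) *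
            ∑ α ∈ T, ‖f (mul γ.1 (inv α.1))‖ * ‖ξ α‖ ^ 2 :=
          Finset.sum_sq_le_sum_mul_sum_of_sq_le_mul T (fun _ _ => norm_nonneg _)
            (fun _ _ => by positivity) (fun _ _ => le_of_eq (by ring))
      _ ≤ _ := by
          gcongr
          exact row_le f T γ
  have hξ : ∑ α ∈ T, ‖ξ α‖ ^ 2 ≤ ‖ξ‖ ^ 2 := by
    have := lp.sum_rpow_le_norm_rpow (p := 2) (by norm_num) ξ T
    simpa using this
  calc ∑ γ ∈ S, ‖regFun f ξ γ‖ ^ 2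
      ≤ ∑ γ ∈ S, iNorm f * ∑ α ∈ T, ‖f (mul γ.1 (inv α.1))‖ * ‖ξ α‖ ^ 2 := Finset.sum_le_sum h1
    _ = iNorm f * ∑ α ∈ T, (∑ γ ∈ S, ‖f (mul γ.1 (inv α.1))‖) * ‖ξ α‖ ^ 2 := by
        rw [← Finset.mul_sum, Finset.sum_comm]
        simp_rw [Finset.sum_mul]
    _ ≤ iNorm f * ∑ α ∈ T, iNorm f * ‖ξ α‖ ^ 2 := by
        gcongr with α _
        exact column_le f S α
    _ = iNorm f ^ 2 * ∑ α ∈ T, ‖ξ α‖ ^ 2 := by rw [← Finset.mul_sum]; ring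
    _ ≤ iNorm f ^ 2 * ‖ξ‖ ^ 2 := by gcongr
    _ = _ := by ring

/-- The left regular representation `λ_x` on `ℓ²(G_x)`. -/
noncomputable def leftRegular (x : UnitSpace G) (f : Cc G) :
    lp (fun _ : SFiber (x : G) => ℂ) 2 →L[ℂ] lp (fun _ : SFiber (x : G) => ℂ) 2 :=
  LinearMap.mkContinuous
    { toFun := fun ξ => ⟨regFun f ξ, memℓp_gen' (C := (iNorm f * ‖ξ‖) ^ 2) fun S => by
        simpa using sum_regFun_le f ξ S⟩
      map_add' := fun ξ η => by
        ext γ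
        have h : ∀ ζ : SFiber (x : G) → ℂ, _ := fun ζ => regFun_eq_sum f ζ γ subset_rfl
        simp only [lp.coeFn_add, Pi.add_apply, h, mul_add, Finset.sum_add_distrib]
      map_smul' := fun c ξ => by
        ext γ
        have h : ∀ ζ : SFiber (x : G) → ℂ, _ := fun ζ => regFun_eq_sum f ζ γ subset_rfl
        simp only [lp.coeFn_smul, Pi.smul_apply, h, smul_eq_mul, RingHom.id_apply,
          Finset.mul_sum, mul_left_comm] }
    (iNorm f) fun ξ => by
      refine lp.norm_le_of_forall_sum_le (by norm_num)
        (mul_nonneg (iNorm_nonneg f) (norm_nonneg _)) fun S => ?_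
      simpa using sum_regFun_le f ξ S

lemma leftRegular_apply (x : UnitSpace G) (f : Cc G) (ξ : lp (fun _ : SFiber (x : G) => ℂ) 2)
    (γ : SFiber (x : G)) :
    leftRegular x f ξ γ = ∑ᶠ α : SFiber (x : G), f (mul γ.1 (inv α.1)) * ξ α := rfl

/-- The reduced norm: the supremum of `‖λ_x(f)‖` over the units `x`. -/
noncomputable def reducedNorm (f : Cc G) : ℝ := ⨆ x : UnitSpace G, ‖leftRegular x f‖

lemma norm_leftRegular_le (x : UnitSpace G) (f : Cc G) : ‖leftRegular x f‖ ≤ iNorm f :=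
  LinearMap.mkContinuous_norm_le _ (iNorm_nonneg f) _

/-- The values `‖π(f)‖`, where `π` runs through the `*`-representations of `C_c(G)` on Hilbert
spaces that are contractive for the `I`-norm, that is, the restrictions to `C_c(G)` of the
contractive `*`-representations of its completion `L¹(G)`. -/
def representationNorms (f : Cc G) : Set ℝ :=
  {c | ∃ (H : Type u) (_ : NormedAddCommGroup H) (_ : InnerProductSpace ℂ H)
    (_ : CompleteSpace H) (π : Cc G →⋆ₙₐ[ℂ] (H →L[ℂ] H)),
    (∀ g : Cc G, ‖π g‖ ≤ iNorm g) ∧ c = ‖π f‖}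

/-- The maximal norm. -/
noncomputable def maximalNorm (f : Cc G) : ℝ := sSup (representationNorms f)

end Norms

/-! ### `C*`-norms on `C_c(G)` and their completions -/

section Completion

variable (G) in
/-- A `C*`-norm on the `*`-algebra `C_c(G)`. -/
structure CStarNorm [GroupoidStructure G] [EtaleGroupoid G] [T2Space G] extends
    AddGroupNorm (Cc G) where
  smul' : ∀ (c : ℂ) (f : Cc G), toFun (c • f) = ‖c‖ * toFun f
  mul_le' : ∀ f g : Cc G, toFun (f * g) ≤ toFun f * toFun g
  star_mul_self' : ∀ f : Cc G, toFun (star f * f) = toFun f ^ 2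

variable [GroupoidStructure G] [EtaleGroupoid G] [T2Space G]

namespace CStarNorm

instance : CoeFun (CStarNorm G) fun _ => Cc G → ℝ := ⟨fun ν => ν.toFun⟩

/-- The norm dominates the reduced norm. -/
def DominatesReduced (ν : CStarNorm G) : Prop := ∀ f, reducedNorm f ≤ ν f

/-- The `*`-algebra `C_c(G)`, normed by `ν`. -/
def Alg (_ : CStarNorm G) : Type u := Cc G

variable [CompactSpace (UnitSpace G)] (ν : CStarNorm G)

noncomputable instance : Ring ν.Alg := inferInstanceAs (Ring (Cc G))
noncomputable instance : StarRing ν.Alg := inferInstanceAs (StarRing (Cc G))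
noncomputable instance : Algebra ℂ ν.Alg := inferInstanceAs (Algebra ℂ (Cc G))
instance : StarModule ℂ ν.Alg := inferInstanceAs (StarModule ℂ (Cc G))

noncomputable instance : NormedRing ν.Alg where
  __ := (inferInstance : Ring ν.Alg)
  __ := AddGroupNorm.toNormedAddCommGroup (E := Cc G) ν.toAddGroupNorm
  norm_mul_le f g := ν.mul_le' f g

noncomputable instance : NormedAlgebra ℂ ν.Alg where
  norm_smul_le c f := (ν.smul' c f).le

instance : CStarRing ν.Alg where
  norm_mul_self_le f := by
    have h : ‖star f * f‖ = ‖f‖ ^ 2 := ν.star_mul_self' f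
    rw [h, sq]

/-- The groupoid `C*`-algebra `C*_ν(G)`. -/
abbrev Completion : Type u := UniformSpace.Completion ν.Alg

/-- The inclusion of the continuous functions on the unit space into `C*_ν(G)`. -/
noncomputable def unitFunction (f : C(UnitSpace G, ℂ)) : ν.Completion :=
  UniformSpace.Completion.coe' (α := ν.Alg) (Cc.inclusion f)

end CStarNorm

end Completion

end Cc

/-! ### Bisections, invariant measures and essential freeness -/

section Measures

variable {G : Type u} [GroupoidStructure G] [TopologicalSpace G]

/-- A bisection: source and range restrict to homeomorphisms of `B` onto the images. -/
def IsBisection (B : Set G) : Prop :=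
  Topology.IsEmbedding (B.domRestrict s) ∧ Topology.IsEmbedding (B.domRestrict r)

/-- The homeomorphism `α_B : s(B) → r(B)`, `x ↦ r ((s|_B)⁻¹ x)`, of a bisection `B`. -/
noncomputable def bisectionHomeo {B : Set G} (hB : IsBisection B) : s '' B ≃ₜ r '' B :=
  (Homeomorph.setCongr (Set.range_domRestrict s B)).symm.trans
    (hB.1.toHomeomorph.symm.trans
      (hB.2.toHomeomorph.trans (Homeomorph.setCongr (Set.range_domRestrict r B))))

/-- The fixed points of `α_B`. -/
def fixedPoints {B : Set G} (hB : IsBisection B) : Set (UnitSpace G) :=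
  {x | ∃ hx : x ∈ s '' B, (bisectionHomeo hB ⟨x, hx⟩ : UnitSpace G) = x}

variable [MeasurableSpace G]

/-- A measure on the unit space is invariant if `α_B` pushes its restriction to `s(B)` forward to
its restriction to `r(B)`, for every open bisection `B`. -/
def IsInvariantMeasure (μ : MeasureTheory.Measure (UnitSpace G)) : Prop :=
  ∀ (B : Set G) (hB : IsBisection B), IsOpen B →
    (μ.comap (Subtype.val : s '' B → UnitSpace G)).map (bisectionHomeo hB) =
      μ.comap (Subtype.val : r '' B → UnitSpace G)

variable (G) in
/-- The set `M(G)` of invariant probability Radon measures on the unit space. -/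
def invariantMeasures : Set (MeasureTheory.FiniteMeasure (UnitSpace G)) :=
  {μ | MeasureTheory.IsProbabilityMeasure (μ : MeasureTheory.Measure (UnitSpace G)) ∧
    (μ : MeasureTheory.Measure (UnitSpace G)).Regular ∧
    IsInvariantMeasure (μ : MeasureTheory.Measure (UnitSpace G))}

/-- Essential freeness with respect to a measure: `μ (Fix α_B) = 0` for every pre-compact open
bisection `B` that contains no units. -/
def EssentiallyFreeFor (μ : MeasureTheory.Measure (UnitSpace G)) : Prop :=
  ∀ (B : Set G) (hB : IsBisection B), IsOpen B → IsCompact (closure B) → Disjoint B (units G) →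
    μ (fixedPoints hB) = 0

variable (G) in
/-- Essential freeness: essential freeness with respect to all invariant probability Radon
measures on the unit space. -/
def EssentiallyFree : Prop :=
  ∀ μ ∈ invariantMeasures G, EssentiallyFreeFor (μ : MeasureTheory.Measure (UnitSpace G))

variable [EtaleGroupoid G] [T2Space G] [CompactSpace (UnitSpace G)]

/-- `μ` is the measure associated with the functional `τ` on `C*_ν(G)`: the probability Radon
measure on the unit space with `τ(f) = ∫ f dμ` for all continuous functions `f` on it. -/
def IsAssociatedMeasure {ν : CStarNorm G} (τ : WeakDual ℂ ν.Completion)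
    (μ : MeasureTheory.FiniteMeasure (UnitSpace G)) : Prop :=
  MeasureTheory.IsProbabilityMeasure (μ : MeasureTheory.Measure (UnitSpace G)) ∧
    (μ : MeasureTheory.Measure (UnitSpace G)).Regular ∧
    ∀ f : C(UnitSpace G, ℂ),
      τ (ν.unitFunction f) = ∫ x, f x ∂(μ : MeasureTheory.Measure (UnitSpace G))

/-- The assertion that `τ ↦ μ_τ` is a well-defined affine homeomorphism from the tracial state space
of `C*_ν(G)` onto `M(G)` (weak-`*` topologies), which identifies the extreme boundaries. -/
def TracesAreInvariantMeasures [BorelSpace G] (ν : CStarNorm G) : Prop :=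
  Convex ℝ (tracialStates ν.Completion) ∧ Convex ℝ≥0 (invariantMeasures G) ∧
  ∃ Φ : tracialStates ν.Completion ≃ₜ invariantMeasures G,
    (∀ (τ : tracialStates ν.Completion) (μ : MeasureTheory.FiniteMeasure (UnitSpace G)),
      IsAssociatedMeasure τ.1 μ ↔ μ = (Φ τ).1) ∧
    (∀ (τ₁ τ₂ τ : tracialStates ν.Completion) (a b : ℝ≥0), a + b = 1 →
      τ.1 = (a : ℝ) • τ₁.1 + (b : ℝ) • τ₂.1 → (Φ τ).1 = a • (Φ τ₁).1 + b • (Φ τ₂).1) ∧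
    (∀ τ : tracialStates ν.Completion,
      τ.1 ∈ (tracialStates ν.Completion).extremePoints ℝ ↔
        (Φ τ).1 ∈ (invariantMeasures G).extremePoints ℝ≥0)

end Measures

end GroupoidStructure

/-! Everything rests on the restriction of functions from `G` to the unit space. The value `f γ` is
a matrix coefficient of the left regular representation at `s γ`, so restriction is contractive from
the reduced norm to the sup norm (`norm_apply_le_norm_leftRegular`). Hence for a probability measure
`μ` the functional `f ↦ ∫ f|_{units} dμ` extends to every completion whose norm dominates the
reduced one. It is positive because `f* f` restricts to the sum of `|f|²` over the source fibres.

Traciality is invariance in disguise. With `k α = f(α⁻¹) g(α)`, the restriction of `f * g` is the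
sum of `k` over source fibres and that of `g * f` is the sum over range fibres (`res_mul_eq_pushS`,
`res_mul_eq_pushR`). By `isInvariantMeasure_iff_integral`, a finite regular `μ` is invariant exactly
when both kinds of fibre sums have equal integrals for all `k`. Conversely, a trace restricts to a
measure by Riesz representation. If `k` lives in a bisection and `b` is a cutoff equal to `1` on its
support, then `b* k` and `k b*` are the two fibre sums of `k`, so the trace property gives
invariance (`IsAssociatedMeasure.isInvariantMeasure`).

Essential freeness enters only to show that a trace is determined by its measure. After subtracting
the restriction to the units and localising (`eq_zero_of_locally`), it remains to see that a trace
kills functions supported in a pre-compact open bisection without units. It kills functions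
supported off the isotropy, by commuting with a cutoff that separates source from range. The part
near the isotropy is small by Cauchy–Schwarz, since the fixed points are a null set
(`IsAssociatedMeasure.eq_zero_of_fixedPoints`).

Both directions are weak-`*` continuous, the inverse because all the constructed traces are
contractive and `C_c(G)` is dense. The reduced and maximal norms are suprema of separating families
of `C*`-seminorms bounded by the `I`-norm (`CStarNorm.iSup`). -/

namespace GroupoidStructure

namespace Cc

/-! ### Partitions of unity and localisation of functionals on `C_c(G)` -/

section Localization

variable {G : Type u} [TopologicalSpace G]

/-- The pointwise product of a continuous function and a compactly supported one. -/
noncomputable def smulFun (φ : C(G, ℂ)) (f : Cc G) : Cc G :=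
  of (fun γ => φ γ * f γ) (φ.continuous.mul f.continuous) f.hasCompactSupport.mul_left

@[simp] lemma smulFun_apply (φ : C(G, ℂ)) (f : Cc G) (γ : G) : smulFun φ f γ = φ γ * f γ := rfl

variable (G) in
/-- Evaluation of functions, as an additive homomorphism. -/
def coeHom : Cc G →+ (G → ℂ) where
  toFun := (⇑)
  map_zero' := rfl
  map_add' _ _ := rfl

lemma coe_sum {ι : Type*} (t : Finset ι) (f : ι → Cc G) (γ : G) :
    (∑ i ∈ t, f i) γ = ∑ i ∈ t, f i γ := by
  have := map_sum (coeHom G) f t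
  have := congrFun this γ
  rw [Finset.sum_apply] at this
  exact this

variable [T2Space G] [LocallyCompactSpace G]

/-- An additive functional vanishes at `f` if it vanishes at all functions with small support
inside of the support of `f`. -/
lemma eq_zero_of_locally {M : Type*} [AddCommGroup M] (L : Cc G →+ M) (f : Cc G)
    (h : ∀ γ ∈ tsupport f, ∃ U ∈ 𝓝 γ, ∀ g : Cc G, tsupport g ⊆ U →
      Function.support g ⊆ Function.support f → L g = 0) : L f = 0 := by
  choose! U hU hL using h
  obtain ⟨t, ht, hcov⟩ := f.hasCompactSupport.elim_nhds_subcover (fun γ => interior (U γ))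
    (fun γ hγ => interior_mem_nhds.2 (hU γ hγ))
  have hcov' : tsupport f ⊆ ⋃ i : Fin t.card, interior (U (t.equivFin.symm i : G)) := by
    intro γ hγ
    obtain ⟨x, hx, hγx⟩ := Set.mem_iUnion₂.1 (hcov hγ)
    refine Set.mem_iUnion.2 ⟨t.equivFin ⟨x, hx⟩, ?_⟩
    simpa using hγx
  obtain ⟨φ, hφs, hφ1, -, -⟩ := exists_continuous_sum_one_of_isOpen_isCompact
    (fun _ => isOpen_interior) f.hasCompactSupport hcov'
  let ψ : Fin t.card → C(G, ℂ) := fun i => ⟨fun γ => (φ i γ : ℂ), by fun_prop⟩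
  -- The partition functions need to sum to `1` only on the support of `f`, since both sides vanish
  -- elsewhere.
  have hsum : f = ∑ i, smulFun (ψ i) f := by
    refine coe_inj (funext fun γ => ?_)
    rw [coe_sum]
    simp only [smulFun_apply, ← Finset.sum_mul]
    by_cases hγ : γ ∈ tsupport f
    · have h1 := hφ1 hγ
      rw [Finset.sum_apply] at h1
      have h2 : ∑ i, ψ i γ = 1 := by
        have := congrArg (fun z : ℝ => (z : ℂ)) h1
        simpa [ψ] using this
      rw [h2, one_mul]
    · rw [image_eq_zero_of_notMem_tsupport hγ, mul_zero]
  rw [hsum, map_sum]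
  refine Finset.sum_eq_zero fun i _ => hL _ (ht _ (t.equivFin.symm i).2) _ ?_ ?_
  · refine (closure_mono ?_).trans ((hφs i).trans interior_subset)
    intro γ hγ h0
    have h0' : φ i γ = 0 := h0
    exact hγ (by simp [ψ, h0'])
  · intro γ hγ
    exact right_ne_zero_of_mul hγ

end Localization

/-! ### Restriction to the units and sums over source and range fibres -/

section Push

variable {G : Type u} [TopologicalSpace G] [GroupoidStructure G]

/-- The restriction to the unit space. -/
def res (f : Cc G) : C(UnitSpace G, ℂ) := ⟨fun x => f x, f.continuous.comp continuous_subtype_val⟩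

lemma res_apply (f : Cc G) (x : UnitSpace G) : res f x = f x := rfl

variable [EtaleGroupoid G]

/-- The function `α ↦ f(α⁻¹) g(α)`. -/
noncomputable def diag (f g : Cc G) : Cc G :=
  of (fun α => f (inv α) * g α)
    ((f.continuous.comp EtaleGroupoid.continuous_inv).mul g.continuous)
    g.hasCompactSupport.mul_left

lemma diag_apply (f g : Cc G) (α : G) : diag f g α = f (inv α) * g α := rfl

lemma diag_star (f g : Cc G) (α : G) : diag (star f) g α = star (f α) * g α := by
  rw [diag_apply, coe_star, involution, inv_inv']

variable [T2Space G]

/-- Fibres of a local homeomorphism meet compact supports in finite sets, so no `finsum` here takes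
its default value `0`. -/
lemma finsum_fiber_add {p : G → UnitSpace G} (hp : IsLocalHomeomorph p) (f g : Cc G)
    (x : UnitSpace G) :
    ∑ᶠ e ∈ p ⁻¹' {x}, (f + g) e = (∑ᶠ e ∈ p ⁻¹' {x}, f e) + ∑ᶠ e ∈ p ⁻¹' {x}, g e := by
  have hfin : ∀ k : Cc G, (p ⁻¹' {x} ∩ Function.support k).Finite := fun k =>
    (finite_fiber_inter hp k.hasCompactSupport x).subset
      (Set.inter_subset_inter_right _ (subset_tsupport _))
  exact finsum_mem_add_distrib' (hfin f) (hfin g)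

/-- The sums over the fibres of a local homeomorphism onto the unit space. -/
noncomputable def push (p : G → UnitSpace G) (hp : IsLocalHomeomorph p) :
    Cc G →+ C(UnitSpace G, ℂ) where
  toFun k := ⟨fun x => ∑ᶠ e ∈ p ⁻¹' {x}, k e, continuous_push hp k.continuous k.hasCompactSupport⟩
  map_zero' := by ext x; simp
  map_add' f g := ContinuousMap.ext fun x => finsum_fiber_add hp f g x

lemma push_apply {p : G → UnitSpace G} (hp : IsLocalHomeomorph p) (k : Cc G) (x : UnitSpace G) :
    push p hp k x = ∑ᶠ e ∈ p ⁻¹' {x}, k e := rfl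

/-- The value of the fibre sum of a function supported in a set on which `p` is injective. -/
lemma push_apply_of_injOn {p : G → UnitSpace G} (hp : IsLocalHomeomorph p) (k : Cc G)
    {B : Set G} (hB : Set.InjOn p B) (hk : Function.support k ⊆ B) {b : G} (hb : b ∈ B) :
    push p hp k (p b) = k b := by
  rw [push_apply, ← finsum_mem_singleton (a := b) (f := k)]
  refine finsum_mem_inter_support_eq _ _ _ (Set.ext fun e => and_congr_left fun he => ?_)
  refine ⟨fun h => hB (hk he) hb h, ?_⟩
  rintro rfl
  rfl

lemma push_apply_of_notMem {p : G → UnitSpace G} (hp : IsLocalHomeomorph p) (k : Cc G)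
    {B : Set G} (hk : Function.support k ⊆ B) {x : UnitSpace G} (hx : x ∉ p '' B) :
    push p hp k x = 0 := by
  rw [push_apply]
  refine finsum_mem_eq_zero_of_forall_eq_zero fun e he => ?_
  by_contra hne
  exact hx ⟨e, hk hne, he⟩

variable (G) in
/-- The sums over the arrows with given source. -/
noncomputable abbrev pushS : Cc G →+ C(UnitSpace G, ℂ) := push s isLocalHomeomorph_s

variable (G) in
/-- The sums over the arrows with given range. -/
noncomputable abbrev pushR : Cc G →+ C(UnitSpace G, ℂ) :=
  push r EtaleGroupoid.isLocalHomeomorph_r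

/-- At a unit `x` the convolution runs over the arrows `α` with source `x`, and there `x α⁻¹ = α⁻¹`.
-/
lemma res_mul_eq_pushS (f g : Cc G) : res (f * g) = pushS G (diag f g) := by
  ext x
  rw [res_apply, coe_mul, conv_eq f g (x := x.1) x.2, push_apply, ← finsum_set_coe_eq_finsum_mem]
  refine finsum_eq_of_bijective (fun α => ⟨α.1, Subtype.ext α.2⟩) ⟨?_, ?_⟩ fun α => ?_
  · intro a b hab
    exact Subtype.ext (congrArg (fun z => z.1) hab)
  · intro a
    exact ⟨⟨a.1, congrArg Subtype.val a.2⟩, rfl⟩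
  · rw [diag_apply]
    have h1 : mul x.1 (inv α.1) = inv α.1 := by
      have h2 : rng (inv α.1) = x.1 := by rw [rng_inv, α.2]
      have h3 := rng_mul_self (inv α.1)
      rwa [h2] at h3
    exact congrArg (fun z => f z * g α.1) h1

/-- Inversion exchanges source fibres with range fibres and the two factors of `diag` with each
other. -/
lemma pushS_diag_comm (f g : Cc G) : pushS G (diag g f) = pushR G (diag f g) := by
  ext x
  rw [push_apply, push_apply, ← finsum_set_coe_eq_finsum_mem, ← finsum_set_coe_eq_finsum_mem]
  refine finsum_eq_of_bijective (fun α => ⟨inv α.1, ?_⟩) ⟨?_, ?_⟩ fun α => ?_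
  · have h : s α.1 = x := α.2
    show r (inv α.1) = x
    exact (Subtype.ext (rng_inv _)).trans h
  · intro a b hab
    have := congrArg (fun z => inv z.1) hab
    simp only [inv_inv'] at this
    exact Subtype.ext this
  · intro a
    have h : r a.1 = x := a.2
    refine ⟨⟨inv a.1, ?_⟩, Subtype.ext (inv_inv' _)⟩
    show s (inv a.1) = x
    exact (Subtype.ext (src_inv _)).trans h
  · simp only [diag_apply, inv_inv', mul_comm]

/-- Together with `res_mul_eq_pushS`, this turns the comparison of `f * g` with `g * f` into a
comparison of the two fibre sums of one function. -/
lemma res_mul_eq_pushR (f g : Cc G) : res (g * f) = pushR G (diag f g) := by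
  rw [res_mul_eq_pushS, pushS_diag_comm]

/-- The product `f* g` of functions supported in a set on which the range map is injective is
supported in the units. -/
lemma star_mul_apply_eq_zero {f g : Cc G} {B : Set G} (hB : Set.InjOn (r : G → UnitSpace G) B)
    (hf : Function.support f ⊆ B) (hg : Function.support g ⊆ B) {γ : G} (hγ : γ ∉ units G) :
    (star f * g) γ = 0 := by
  rw [coe_mul, conv]
  refine finsum_eq_zero_of_forall_eq_zero fun α => ?_
  by_contra hne
  have h1 := right_ne_zero_of_mul hne
  have h2 := left_ne_zero_of_mul hne
  rw [coe_star, involution, inv_mul_inv α.2.symm] at h2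
  have h3 : f (mul α.1 (inv γ)) ≠ 0 := fun h => h2 (by rw [h, star_zero])
  have hc : src α.1 = rng (inv γ) := by rw [rng_inv, α.2]
  -- Both arrows lie in `B` and have the same range, so they agree; cancelling `α` shows that `γ` is
  -- a unit.
  have h4 : mul α.1 (inv γ) = α.1 := hB (hf h3) (hg h1) (Subtype.ext (rng_mul _ _ hc))
  have h5 := congrArg src h4
  rw [src_mul _ _ hc, src_inv, α.2] at h5
  have h6 : mul (inv α.1) (mul α.1 (inv γ)) = mul (inv α.1) α.1 := by rw [h4]
  rw [← mul_assoc _ _ _ (src_inv _) hc, inv_mul, α.2, ← rng_inv γ, rng_mul_self] at h6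
  apply hγ
  show src γ = γ
  have h7 := congrArg inv h6
  rw [inv_inv', rng_inv, inv_of_mem_units (src_src γ)] at h7
  exact h7.symm

/-- The product `f g*` of functions supported in a set on which the source map is injective is
supported in the units. -/
lemma mul_star_apply_eq_zero {f g : Cc G} {B : Set G} (hB : Set.InjOn (s : G → UnitSpace G) B)
    (hf : Function.support f ⊆ B) (hg : Function.support g ⊆ B) {γ : G} (hγ : γ ∉ units G) :
    (f * star g) γ = 0 := by
  rw [coe_mul, conv]
  refine finsum_eq_zero_of_forall_eq_zero fun α => ?_
  by_contra hne
  have h1 := right_ne_zero_of_mul hne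
  have h2 := left_ne_zero_of_mul hne
  rw [coe_star, involution] at h1
  have h3 : g (inv α.1) ≠ 0 := fun h => h1 (by rw [h, star_zero])
  have hc : src γ = rng (inv α.1) := by rw [rng_inv, α.2]
  -- Here the two arrows of `B` share their source; cancelling `α⁻¹` on the right again makes `γ` a
  -- unit.
  have h4 : mul γ (inv α.1) = inv α.1 := hB (hf h2) (hg h3) (Subtype.ext (src_mul _ _ hc))
  have h5 := inv_mul_cancel_right' α.2.symm
  rw [h4, inv_mul, α.2] at h5
  exact hγ h5

/-- The value at `x` is the sum of `|f α|²` over the arrows with source `x`. -/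
lemma res_star_mul_nonneg (f : Cc G) (x : UnitSpace G) : 0 ≤ res (star f * f) x := by
  rw [res_mul_eq_pushS, push_apply]
  refine finsum_nonneg fun e => finsum_nonneg fun _ => ?_
  rw [diag_star]
  exact star_mul_self_nonneg _

/-! ### Functions on the unit space as elements of the convolution algebra -/

variable [CompactSpace (UnitSpace G)]

lemma inclusion_apply (f : C(UnitSpace G, ℂ)) (x : UnitSpace G) : inclusion f x = f x := by
  have : inclusion f x = (units G).indicator (fun γ => f (s γ)) x := rfl
  rw [this, Set.indicator_of_mem x.2]
  exact congrArg f (Subtype.ext x.2)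

lemma inclusion_apply_of_notMem (f : C(UnitSpace G, ℂ)) {γ : G} (h : γ ∉ units G) :
    inclusion f γ = 0 := by
  have : inclusion f γ = (units G).indicator (fun γ => f (s γ)) γ := rfl
  rw [this, Set.indicator_of_notMem h]

lemma res_inclusion (f : C(UnitSpace G, ℂ)) : res (inclusion f) = f :=
  ContinuousMap.ext fun x => inclusion_apply f x

lemma eq_inclusion_res {f : Cc G} (h : ∀ γ ∉ units G, f γ = 0) : f = inclusion (res f) := by
  refine coe_inj (funext fun γ => ?_)
  by_cases hγ : γ ∈ units G
  · exact (inclusion_apply (res f) ⟨γ, hγ⟩).symm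
  · rw [h γ hγ, inclusion_apply_of_notMem _ hγ]

lemma inclusion_mul (f : C(UnitSpace G, ℂ)) (g : Cc G) (γ : G) :
    (inclusion f * g) γ = f (r γ) * g γ := by
  rw [coe_mul]
  have : conv (inclusion f) g = _ := conv_indicator_left (fun γ => f (s γ)) g
  rw [this]
  show f (s (rng γ)) * _ = _
  congr 2
  exact Subtype.ext (src_rng γ)

lemma mul_inclusion (f : C(UnitSpace G, ℂ)) (g : Cc G) (γ : G) :
    (g * inclusion f) γ = g γ * f (s γ) := by
  rw [coe_mul]
  have : conv g (inclusion f) = _ := conv_indicator_right (fun γ => f (s γ)) g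
  rw [this]
  show _ * f (s (src γ)) = _
  congr 2
  exact Subtype.ext (src_src γ)

/-- The inclusion of the functions on the unit space, as a unital `*`-homomorphism. -/
noncomputable def inclusionHom : C(UnitSpace G, ℂ) →⋆ₐ[ℂ] Cc G where
  toFun := inclusion
  map_one' := rfl
  map_mul' f g := coe_inj (funext fun γ => by
    rw [inclusion_mul]
    by_cases hγ : γ ∈ units G
    · have h1 := inclusion_apply (f * g) ⟨γ, hγ⟩
      have h2 := inclusion_apply g ⟨γ, hγ⟩
      simp only at h1 h2
      rw [h1, h2, ContinuousMap.mul_apply]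
      congr 2
      exact Subtype.ext (rng_of_mem_units hγ).symm
    · rw [inclusion_apply_of_notMem _ hγ, inclusion_apply_of_notMem _ hγ, mul_zero])
  map_zero' := by
    refine coe_inj (funext fun γ => ?_)
    by_cases hγ : γ ∈ units G
    · exact inclusion_apply 0 ⟨γ, hγ⟩
    · exact inclusion_apply_of_notMem _ hγ
  map_add' f g := by
    refine coe_inj (funext fun γ => ?_)
    rw [coe_add, Pi.add_apply]
    by_cases hγ : γ ∈ units G
    · have h := fun k => inclusion_apply k ⟨γ, hγ⟩
      simp only at h
      simp only [h, ContinuousMap.add_apply]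
    · simp only [inclusion_apply_of_notMem _ hγ, add_zero]
  commutes' c := by
    refine coe_inj (funext fun γ => ?_)
    rw [Algebra.algebraMap_eq_smul_one, Algebra.algebraMap_eq_smul_one, coe_smul, Pi.smul_apply]
    show _ = c • inclusion 1 γ
    by_cases hγ : γ ∈ units G
    · have h := fun k => inclusion_apply k ⟨γ, hγ⟩
      simp only at h
      simp only [h, ContinuousMap.smul_apply]
    · simp only [inclusion_apply_of_notMem _ hγ, smul_zero]
  map_star' f := by
    refine coe_inj (funext fun γ => ?_)
    rw [coe_star, involution]
    by_cases hγ : γ ∈ units G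
    · have h := fun k => inclusion_apply k ⟨γ, hγ⟩
      simp only at h
      rw [inv_of_mem_units hγ, h, h, ContinuousMap.star_apply]
    · have hγ' : inv γ ∉ units G := fun hu => hγ (by
        have := inv_of_mem_units hu
        rw [inv_inv'] at this
        rw [this]; exact hu)
      simp only [inclusion_apply_of_notMem _ hγ, inclusion_apply_of_notMem _ hγ', star_zero]

end Push

end Cc

/-! ### Invariance of measures in terms of fibre sums -/

section Invariance

open MeasureTheory Cc

section

variable {X Y : Type*} [TopologicalSpace X] [MeasurableSpace X] [BorelSpace X]
  [TopologicalSpace Y] [MeasurableSpace Y] [BorelSpace Y]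

/-- Used to move measures on `s(B)` and `r(B)` back to the bisection `B` itself. -/
lemma comap_val_comp_homeomorph (μ : Measure X) {V : Set X} (hV : MeasurableSet V)
    (e : Y ≃ₜ V) : μ.comap (fun y => (e y : X)) = (μ.comap (Subtype.val : V → X)).map e.symm := by
  have hval := MeasurableEmbedding.subtype_coe hV
  have he : MeasurableEmbedding fun y => (e y : X) := hval.comp e.measurableEmbedding
  ext C hC
  rw [he.comap_apply, e.symm.measurableEmbedding.map_apply, hval.comap_apply,
    ← Set.image_image (fun v : V => (v : X)) e C, e.image_eq_preimage_symm]

end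

variable {G : Type u} [TopologicalSpace G]

/-- The extension by zero of a compactly supported function on an open set. -/
noncomputable def Cc.extendZero [T2Space G] {B : Set G} (ho : IsOpen B) (f : C_c(B, ℝ)) : Cc G :=
  of (fun γ => ((Subtype.val.extend f 0 γ : ℝ) : ℂ))
    (Complex.continuous_ofReal.comp
      (f.hasCompactSupport.continuous_extend_zero ho f.continuous))
    ((f.hasCompactSupport.extend_zero continuous_subtype_val).comp_left
      (g := fun z : ℝ => (z : ℂ)) (by simp))

lemma Cc.extendZero_apply [T2Space G] {B : Set G} (ho : IsOpen B) (f : C_c(B, ℝ)) (b : B) :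
    extendZero ho f b = (f b : ℂ) := by
  show ((Subtype.val.extend f 0 b.1 : ℝ) : ℂ) = _
  rw [Subtype.val_injective.extend_apply]

lemma Cc.support_extendZero [T2Space G] {B : Set G} (ho : IsOpen B) (f : C_c(B, ℝ)) :
    Function.support (extendZero ho f) ⊆ B := by
  intro γ hγ
  by_contra h
  apply hγ
  show ((Subtype.val.extend f 0 γ : ℝ) : ℂ) = 0
  rw [Function.extend_apply' _ _ _ (by rintro ⟨b, rfl⟩; exact h b.2)]
  simp

variable [GroupoidStructure G]

lemma isOpenEmbedding_domRestrict {p : G → UnitSpace G} (hp : IsLocalHomeomorph p) {B : Set G}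
    (hB : Set.InjOn p B) (ho : IsOpen B) : Topology.IsOpenEmbedding (B.domRestrict p) :=
  .of_continuous_injective_isOpenMap (hp.continuous.comp continuous_subtype_val)
    (Set.injOn_iff_injective.1 hB) (hp.isOpenMap.domRestrict ho)

/-- A bisection is homeomorphic to its image under the source map. -/
noncomputable def sourceHomeo {B : Set G} (hB : IsBisection B) : B ≃ₜ s '' B :=
  hB.1.toHomeomorph.trans (Homeomorph.setCongr (Set.range_domRestrict s B))

/-- A bisection is homeomorphic to its image under the range map. -/
noncomputable def rangeHomeo {B : Set G} (hB : IsBisection B) : B ≃ₜ r '' B :=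
  hB.2.toHomeomorph.trans (Homeomorph.setCongr (Set.range_domRestrict r B))

lemma bisectionHomeo_eq {B : Set G} (hB : IsBisection B) :
    bisectionHomeo hB = (sourceHomeo hB).symm.trans (rangeHomeo hB) := rfl

lemma bisectionHomeo_apply {B : Set G} (hB : IsBisection B) {b : G} (hb : b ∈ B)
    (h : s b ∈ s '' B) : (bisectionHomeo hB ⟨s b, h⟩ : UnitSpace G) = r b := by
  have h1 : (⟨s b, h⟩ : s '' B) = sourceHomeo hB ⟨b, hb⟩ := rfl
  rw [bisectionHomeo_eq, h1, Homeomorph.trans_apply, Homeomorph.symm_apply_apply]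
  rfl

lemma IsBisection.injOn_s {B : Set G} (hB : IsBisection B) : Set.InjOn s B :=
  Set.injOn_iff_injective.2 hB.1.injective

lemma IsBisection.injOn_r {B : Set G} (hB : IsBisection B) : Set.InjOn r B :=
  Set.injOn_iff_injective.2 hB.2.injective

section

variable [CompactSpace (UnitSpace G)] [MeasurableSpace G] [BorelSpace G]

lemma integrable_continuousMap (μ : Measure (UnitSpace G)) [IsFiniteMeasure μ]
    (f : C(UnitSpace G, ℂ)) : Integrable f μ :=
  f.continuous.integrable_of_hasCompactSupport (HasCompactSupport.of_compactSpace _)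

/-- Integration of continuous functions over a finite measure on the unit space. -/
noncomputable def integralHom (μ : Measure (UnitSpace G)) [IsFiniteMeasure μ] :
    C(UnitSpace G, ℂ) →+ ℂ where
  toFun f := ∫ x, f x ∂μ
  map_zero' := by simp
  map_add' f g := integral_add (integrable_continuousMap μ f) (integrable_continuousMap μ g)

end

section

variable [EtaleGroupoid G]

/-- Source and range are open maps, so injectivity on an open set already makes them embeddings
there. -/
lemma IsBisection.of_injOn {B : Set G} (ho : IsOpen B) (hs : Set.InjOn s B) (hr : Set.InjOn r B) :
    IsBisection B :=
  ⟨(isOpenEmbedding_domRestrict isLocalHomeomorph_s hs ho).isEmbedding,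
    (isOpenEmbedding_domRestrict EtaleGroupoid.isLocalHomeomorph_r hr ho).isEmbedding⟩

/-- Every arrow has an open bisection as a neighbourhood. -/
lemma exists_bisection_mem_nhds (γ : G) : ∃ B : Set G, IsOpen B ∧ γ ∈ B ∧ IsBisection B := by
  obtain ⟨e, he, hs⟩ := isLocalHomeomorph_s γ
  obtain ⟨e', he', hr⟩ := EtaleGroupoid.isLocalHomeomorph_r γ
  have ho := e.open_source.inter e'.open_source
  refine ⟨e.source ∩ e'.source, ho, ⟨he, he'⟩, .of_injOn ho ?_ ?_⟩
  · rw [hs]; exact e.injOn.mono Set.inter_subset_left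
  · rw [hr]; exact e'.injOn.mono Set.inter_subset_right

variable [MeasurableSpace G] [BorelSpace G]

/-- Since `α_B` is the range homeomorphism of `B` after the inverse of the source homeomorphism,
undoing the former puts both measures on `B`, where source and range play symmetric roles. -/
lemma isInvariantMeasure_iff_comap (μ : Measure (UnitSpace G)) :
    IsInvariantMeasure μ ↔ ∀ B : Set G, IsBisection B → IsOpen B →
      μ.comap (B.domRestrict s) = μ.comap (B.domRestrict r) := by
  refine forall_congr' fun B => forall_congr' fun hB => forall_congr' fun ho => ?_
  have hs : IsOpen (s '' B) := isLocalHomeomorph_s.isOpenMap _ ho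
  have hr : IsOpen (r '' B) := EtaleGroupoid.isLocalHomeomorph_r.isOpenMap _ ho
  have e1 : μ.comap (B.domRestrict s) = _ :=
    comap_val_comp_homeomorph μ hs.measurableSet (sourceHomeo hB)
  have e2 : μ.comap (B.domRestrict r) = _ :=
    comap_val_comp_homeomorph μ hr.measurableSet (rangeHomeo hB)
  rw [e1, e2, bisectionHomeo_eq]
  have h3 : (μ.comap (Subtype.val : s '' B → UnitSpace G)).map
      ((sourceHomeo hB).symm.trans (rangeHomeo hB)) =
      ((μ.comap (Subtype.val : s '' B → UnitSpace G)).map (sourceHomeo hB).symm).map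
        (rangeHomeo hB) :=
    (Measure.map_map (rangeHomeo hB).continuous.measurable
      (sourceHomeo hB).symm.continuous.measurable).symm
  rw [h3]
  constructor
  · intro h
    rw [← h, Measure.map_map (rangeHomeo hB).symm.continuous.measurable
      (rangeHomeo hB).continuous.measurable, (rangeHomeo hB).symm_comp_self, Measure.map_id]
  · intro h
    rw [h, Measure.map_map (rangeHomeo hB).continuous.measurable
      (rangeHomeo hB).symm.continuous.measurable, (rangeHomeo hB).self_comp_symm, Measure.map_id]

end

variable [EtaleGroupoid G] [T2Space G] [MeasurableSpace G] [BorelSpace G]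

/-- The integral of a fibre sum of a function supported in a bisection. -/
lemma integral_push_eq {p : G → UnitSpace G} (hp : IsLocalHomeomorph p) {B : Set G}
    (hB : Set.InjOn p B) (ho : IsOpen B) (μ : Measure (UnitSpace G)) (k : Cc G)
    (hk : Function.support k ⊆ B) :
    ∫ x, push p hp k x ∂μ = ∫ b : B, k b ∂(μ.comap (B.domRestrict p)) := by
  have hemb := (isOpenEmbedding_domRestrict hp hB ho).measurableEmbedding
  have h1 : ∀ b : B, k b = push p hp k (B.domRestrict p b) := fun b =>
    (push_apply_of_injOn hp k hB hk b.2).symm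
  simp_rw [h1]
  -- Pulling back and pushing forward along the embedding restricts `μ` to the image of `B`; off
  -- this image the fibre sum is zero.
  rw [← hemb.integral_map, hemb.map_comap, setIntegral_eq_integral_of_forall_compl_eq_zero]
  intro x hx
  exact push_apply_of_notMem hp k hk (by rwa [Set.range_domRestrict] at hx)

variable [CompactSpace (UnitSpace G)]

variable [LocallyCompactSpace G]

/-- A finite regular measure is invariant if and only if integrating over it the sums over the
source fibres gives the same as integrating the sums over the range fibres. -/
lemma isInvariantMeasure_iff_integral (μ : Measure (UnitSpace G)) [IsFiniteMeasure μ]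
    [μ.Regular] :
    IsInvariantMeasure μ ↔ ∀ k : Cc G, ∫ x, pushS G k x ∂μ = ∫ x, pushR G k x ∂μ := by
  rw [isInvariantMeasure_iff_comap]
  constructor
  · intro h k
    let L : Cc G →+ ℂ := (integralHom μ).comp (pushS G) - (integralHom μ).comp (pushR G)
    refine sub_eq_zero.1 (show L k = 0 from eq_zero_of_locally L k fun γ _ => ?_)
    obtain ⟨B, ho, hγ, hB⟩ := exists_bisection_mem_nhds γ
    refine ⟨B, ho.mem_nhds hγ, fun g hg _ => ?_⟩
    have hg' := (subset_tsupport g).trans hg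
    refine sub_eq_zero.2 ?_
    have h1 := integral_push_eq isLocalHomeomorph_s hB.injOn_s ho μ g hg'
    have h2 := integral_push_eq EtaleGroupoid.isLocalHomeomorph_r hB.injOn_r ho μ g hg'
    rw [h B hB ho, ← h2] at h1
    exact h1
  · intro h B hB ho
    have e1 := isOpenEmbedding_domRestrict isLocalHomeomorph_s hB.injOn_s ho
    have e2 := isOpenEmbedding_domRestrict EtaleGroupoid.isLocalHomeomorph_r hB.injOn_r ho
    have : LocallyCompactSpace B := ho.locallyCompactSpace
    have := Measure.Regular.comap' μ e1
    have := Measure.Regular.comap' μ e2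
    -- Both pulled-back measures are regular on the locally compact space `B`, so compactly
    -- supported test functions decide; extended by zero, they become elements of `C_c(G)` supported
    -- in `B`.
    refine Measure.ext_of_integral_eq_on_compactlySupported fun f => ?_
    have hk := h (extendZero ho f)
    rw [integral_push_eq isLocalHomeomorph_s hB.injOn_s ho μ _ (support_extendZero ho f),
      integral_push_eq EtaleGroupoid.isLocalHomeomorph_r hB.injOn_r ho μ _
        (support_extendZero ho f)] at hk
    simp_rw [extendZero_apply] at hk
    rw [integral_complex_ofReal, integral_complex_ofReal] at hk
    exact_mod_cast hk

lemma integral_res_mul_comm {μ : Measure (UnitSpace G)} [IsFiniteMeasure μ] [μ.Regular]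
    (h : IsInvariantMeasure μ) (f g : Cc G) :
    ∫ x, res (f * g) x ∂μ = ∫ x, res (g * f) x ∂μ := by
  rw [res_mul_eq_pushS, res_mul_eq_pushR, (isInvariantMeasure_iff_integral μ).1 h]

end Invariance

/-! ### The left regular representations as `*`-representations -/

section RegularRepresentation

/-- The common source is a separate variable `x`, so that both arrows can be taken from `SFiber x`
without a cast. -/
lemma conv_translate_of_src {G : Type u} [GroupoidStructure G] (f g : G → ℂ) {x γ α : G} (hγ : src γ = x) (hα : src α = x) :
    conv f g (mul γ (inv α)) = ∑ᶠ δ : SFiber x, f (mul γ (inv δ)) * g (mul δ (inv α)) := by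
  subst hγ
  exact conv_translate f g hα.symm

variable {G : Type u} [TopologicalSpace G] [GroupoidStructure G] [EtaleGroupoid G] [T2Space G]

lemma leftRegular_apply_sum (x : UnitSpace G) (f : Cc G) (ξ : lp (fun _ : SFiber (x : G) => ℂ) 2)
    (γ : SFiber (x : G)) {T : Finset (SFiber (x : G))} (hT : (finite_row f γ).toFinset ⊆ T) :
    leftRegular x f ξ γ = ∑ α ∈ T, f (mul γ.1 (inv α.1)) * ξ α :=
  regFun_eq_sum f ξ γ hT

lemma leftRegular_add (x : UnitSpace G) (f g : Cc G) :
    leftRegular x (f + g) = leftRegular x f + leftRegular x g := by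
  classical
  ext ξ γ
  let T := (finite_row f γ).toFinset ∪ (finite_row g γ).toFinset ∪ (finite_row (f + g) γ).toFinset
  show leftRegular x (f + g) ξ γ = leftRegular x f ξ γ + leftRegular x g ξ γ
  rw [leftRegular_apply_sum x f ξ γ (T := T) (by grind),
    leftRegular_apply_sum x g ξ γ (T := T) (by grind),
    leftRegular_apply_sum x (f + g) ξ γ (T := T) (by grind), ← Finset.sum_add_distrib]
  exact Finset.sum_congr rfl fun α _ => by simp [add_mul]

lemma leftRegular_smul (x : UnitSpace G) (c : ℂ) (f : Cc G) :
    leftRegular x (c • f) = c • leftRegular x f := by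
  ext ξ γ
  show leftRegular x (c • f) ξ γ = c • leftRegular x f ξ γ
  rw [leftRegular_apply, leftRegular_apply, smul_finsum]
  exact finsum_congr fun α => by simp [_root_.mul_assoc]

lemma leftRegular_mul (x : UnitSpace G) (f g : Cc G) :
    leftRegular x (f * g) = leftRegular x f * leftRegular x g := by
  classical
  ext ξ γ
  show leftRegular x (f * g) ξ γ = leftRegular x f (leftRegular x g ξ) γ
  set S := (finite_row f γ).toFinset
  -- One finite index set large enough for every row of `g` that meets `S` and for the row of `f *
  -- g`; the sums can then be interchanged freely.
  set T := (S.biUnion fun δ => (finite_row g δ).toFinset) ∪ (finite_row (f * g) γ).toFinset with hT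
  rw [leftRegular_apply_sum x (f * g) ξ γ (T := T) Finset.subset_union_right,
    leftRegular_apply_sum x f _ γ (T := S) subset_rfl]
  have h1 : ∀ δ ∈ S, leftRegular x g ξ δ = ∑ α ∈ T, g (mul δ.1 (inv α.1)) * ξ α := fun δ hδ =>
    leftRegular_apply_sum x g ξ δ ((Finset.subset_biUnion_of_mem
      (fun δ => (finite_row g δ).toFinset) hδ).trans Finset.subset_union_left)
  have h2 : ∀ α : SFiber (x : G), (f * g) (mul γ.1 (inv α.1)) =
      ∑ δ ∈ S, f (mul γ.1 (inv δ.1)) * g (mul δ.1 (inv α.1)) := by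
    intro α
    rw [Cc.coe_mul, conv_translate_of_src f g γ.2 α.2]
    refine finsum_eq_sum_of_support_subset _ fun δ hδ => ?_
    simpa [S] using left_ne_zero_of_mul hδ
  have h3 : ∀ δ ∈ S, f (mul γ.1 (inv δ.1)) * leftRegular x g ξ δ =
      ∑ α ∈ T, f (mul γ.1 (inv δ.1)) * (g (mul δ.1 (inv α.1)) * ξ α) := fun δ hδ => by
    rw [h1 δ hδ, Finset.mul_sum]
  have h4 : ∀ α ∈ T, (f * g) (mul γ.1 (inv α.1)) * ξ α =
      ∑ δ ∈ S, f (mul γ.1 (inv δ.1)) * (g (mul δ.1 (inv α.1)) * ξ α) := fun α _ => by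
    simp_rw [h2 α, Finset.sum_mul, _root_.mul_assoc]
  rw [Finset.sum_congr rfl h4, Finset.sum_comm]
  exact (Finset.sum_congr rfl h3).symm

lemma leftRegular_single (x : UnitSpace G) (f : Cc G) [DecidableEq (SFiber (x : G))]
    (α γ : SFiber (x : G)) :
    leftRegular x f (lp.single 2 α (1 : ℂ)) γ = f (mul γ.1 (inv α.1)) := by
  rw [leftRegular_apply, finsum_eq_single _ α]
  · simp
  · intro β hβ
    simp [hβ]

/-- The matrix of `λ_x(f)` has entries `f(γ α⁻¹)`, and `(γ α⁻¹)⁻¹ = α γ⁻¹`, so the involution is the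
conjugate transpose. The adjoint is read off by pairing with basis vectors. -/
lemma leftRegular_star (x : UnitSpace G) (f : Cc G) :
    leftRegular x (star f) = star (leftRegular x f) := by
  classical
  ext η γ
  rw [ContinuousLinearMap.star_eq_adjoint]
  have h1 : (ContinuousLinearMap.adjoint (leftRegular x f) η) γ =
      inner ℂ (lp.single 2 γ (1 : ℂ)) (ContinuousLinearMap.adjoint (leftRegular x f) η) := by
    rw [lp.inner_single_left]; simp
  rw [h1, ContinuousLinearMap.adjoint_inner_right, lp.inner_eq_tsum]
  simp only [leftRegular_single]
  rw [leftRegular_apply, tsum_eq_finsum]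
  · refine finsum_congr fun α => ?_
    rw [Cc.coe_star, involution, inv_mul_inv (γ.2.trans α.2.symm)]
    simp [mul_comm]
  · refine (finite_row (star f) γ).subset fun α hα h0 => hα ?_
    have h0' : star (f (inv (mul γ.1 (inv α.1)))) = 0 := h0
    rw [inv_mul_inv (γ.2.trans α.2.symm), star_eq_zero] at h0'
    show inner ℂ (f (mul α.1 (inv γ.1))) (η α) = 0
    rw [h0', inner_zero_left]

/-- The left regular representation as a `*`-homomorphism. -/
noncomputable def leftRegularHom (x : UnitSpace G) :
    Cc G →⋆ₙₐ[ℂ] (lp (fun _ : SFiber (x : G) => ℂ) 2 →L[ℂ] lp (fun _ : SFiber (x : G) => ℂ) 2) where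
  toFun := leftRegular x
  map_smul' c f := leftRegular_smul x c f
  map_zero' := by simpa using leftRegular_smul x 0 0
  map_add' := leftRegular_add x
  map_mul' := leftRegular_mul x
  map_star' := leftRegular_star x

/-- `f γ` is the `γ`-coordinate of `λ(f)` applied to the unit vector at the unit `src γ`. This makes
the reduced norm separating and restriction to the units contractive. -/
lemma norm_apply_le_norm_leftRegular (f : Cc G) (γ : G) : ‖f γ‖ ≤ ‖leftRegular (s γ) f‖ := by
  classical
  have h1 := leftRegular_single (s γ) f ⟨src γ, src_src γ⟩ ⟨γ, rfl⟩
  simp only [inv_of_mem_units (show src γ ∈ units G from src_src γ), mul_src] at h1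
  rw [← h1]
  refine (lp.norm_apply_le_norm (by norm_num) _ _).trans ?_
  refine (ContinuousLinearMap.le_opNorm _ _).trans (le_of_eq ?_)
  rw [lp.norm_single (by norm_num)]
  simp

lemma bddAbove_norm_leftRegular (f : Cc G) :
    BddAbove (Set.range fun x : UnitSpace G => ‖leftRegular x f‖) :=
  ⟨iNorm f, by rintro _ ⟨x, rfl⟩; exact norm_leftRegular_le x f⟩

lemma norm_leftRegular_le_reducedNorm (x : UnitSpace G) (f : Cc G) :
    ‖leftRegular x f‖ ≤ reducedNorm f :=
  le_ciSup (bddAbove_norm_leftRegular f) x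

lemma norm_apply_le_reducedNorm (f : Cc G) (γ : G) : ‖f γ‖ ≤ reducedNorm f :=
  (norm_apply_le_norm_leftRegular f γ).trans (norm_leftRegular_le_reducedNorm _ f)

end RegularRepresentation

/-! ### The reduced and maximal norms as suprema of `C*`-seminorms -/

section SupNorm

variable {G : Type u} [TopologicalSpace G] [GroupoidStructure G] [EtaleGroupoid G] [T2Space G]

/-- The axioms of a `C*`-seminorm on `C_c(G)` that is dominated by the `I`-norm. -/
structure IsCStarSeminorm (p : Cc G → ℝ) : Prop where
  add_le : ∀ f g, p (f + g) ≤ p f + p g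
  smul : ∀ (c : ℂ) f, p (c • f) = ‖c‖ * p f
  mul_le : ∀ f g, p (f * g) ≤ p f * p g
  star_mul_self : ∀ f, p (star f * f) = p f ^ 2
  nonneg : ∀ f, 0 ≤ p f
  le_iNorm : ∀ f, p f ≤ iNorm f

lemma isCStarSeminorm_norm {A : Type*} [NonUnitalCStarAlgebra A] (π : Cc G →⋆ₙₐ[ℂ] A)
    (h : ∀ f, ‖π f‖ ≤ iNorm f) : IsCStarSeminorm fun f => ‖π f‖ where
  add_le f g := by rw [map_add]; exact norm_add_le _ _
  smul c f := by rw [map_smul, norm_smul]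
  mul_le f g := by rw [map_mul]; exact norm_mul_le _ _
  star_mul_self f := by rw [map_mul, map_star, CStarRing.norm_star_mul_self, sq]
  nonneg f := norm_nonneg _
  le_iNorm := h

variable {ι : Type*} {p : ι → Cc G → ℝ}

/-- The supremum of a separating family of `C*`-seminorms. -/
noncomputable def CStarNorm.iSup (hp : ∀ i, IsCStarSeminorm (p i))
    (hsep : ∀ f, (∀ i, p i f = 0) → f = 0) : CStarNorm G :=
  have hb : ∀ f, BddAbove (Set.range fun i => p i f) := fun f =>
    ⟨iNorm f, by rintro _ ⟨i, rfl⟩; exact (hp i).le_iNorm f⟩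
  have hle : ∀ i f, p i f ≤ ⨆ i, p i f := fun i f => le_ciSup (hb f) i
  have hnn : ∀ f, 0 ≤ ⨆ i, p i f := fun f => Real.iSup_nonneg fun i => (hp i).nonneg f
  have hsmul : ∀ (c : ℂ) f, ⨆ i, p i (c • f) = ‖c‖ * ⨆ i, p i f := fun c f => by
    rw [Real.mul_iSup_of_nonneg (norm_nonneg c)]
    exact iSup_congr fun i => (hp i).smul c f
  { toFun := fun f => ⨆ i, p i f
    map_zero' := by simpa using hsmul 0 0
    add_le' := fun f g => Real.iSup_le (fun i => ((hp i).add_le f g).trans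
      (add_le_add (hle i f) (hle i g))) (add_nonneg (hnn f) (hnn g))
    neg' := fun f => by simpa using hsmul (-1) f
    eq_zero_of_map_eq_zero' := fun f hf => hsep f fun i =>
      le_antisymm ((hle i f).trans hf.le) ((hp i).nonneg f)
    smul' := hsmul
    mul_le' := fun f g => Real.iSup_le (fun i => ((hp i).mul_le f g).trans
      (mul_le_mul (hle i f) (hle i g) ((hp i).nonneg g) (hnn f))) (mul_nonneg (hnn f) (hnn g))
    star_mul_self' := fun f => by
      refine le_antisymm (Real.iSup_le (fun i => ?_) (sq_nonneg _)) ?_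
      · rw [(hp i).star_mul_self]
        exact pow_le_pow_left₀ ((hp i).nonneg f) (hle i f) 2
      -- Taking a root removes the square from the supremum, and the bound can then be checked for
      -- each seminorm.
      · rw [← Real.le_sqrt (hnn f) (hnn _)]
        refine Real.iSup_le (fun i => Real.le_sqrt_of_sq_le ?_) (Real.sqrt_nonneg _)
        rw [← (hp i).star_mul_self]
        exact hle i _ }

lemma isCStarSeminorm_leftRegular (x : UnitSpace G) :
    IsCStarSeminorm fun f => ‖leftRegular x f‖ :=
  isCStarSeminorm_norm (leftRegularHom x) (norm_leftRegular_le x)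

lemma eq_zero_of_forall_leftRegular (f : Cc G) (h : ∀ x, ‖leftRegular x f‖ = 0) : f = 0 :=
  Cc.coe_inj (funext fun γ => norm_le_zero_iff.1
    ((norm_apply_le_norm_leftRegular f γ).trans (h (s γ)).le))

variable (G) in
/-- The reduced norm as a `C*`-norm. -/
noncomputable def reducedCStarNorm : CStarNorm G :=
  .iSup (isCStarSeminorm_leftRegular (G := G)) eq_zero_of_forall_leftRegular

lemma reducedCStarNorm_apply (f : Cc G) : reducedCStarNorm G f = reducedNorm f := rfl

variable (G) in
/-- The `C*`-seminorms given by the `*`-representations of `C_c(G)` on Hilbert spaces that are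
contractive for the `I`-norm. -/
def RepresentationSeminorm : Type u :=
  {p : Cc G → ℝ // ∃ (H : Type u) (_ : NormedAddCommGroup H) (_ : InnerProductSpace ℂ H)
    (_ : CompleteSpace H) (π : Cc G →⋆ₙₐ[ℂ] (H →L[ℂ] H)),
    (∀ g : Cc G, ‖π g‖ ≤ iNorm g) ∧ p = fun f => ‖π f‖}

lemma RepresentationSeminorm.isCStarSeminorm (p : RepresentationSeminorm G) :
    IsCStarSeminorm p.1 := by
  obtain ⟨p, H, _, _, _, π, hπ, rfl⟩ := p
  exact isCStarSeminorm_norm π hπ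

/-- The seminorm of the left regular representation. -/
noncomputable def RepresentationSeminorm.ofUnit (x : UnitSpace G) : RepresentationSeminorm G :=
  ⟨fun f => ‖leftRegular x f‖, _, _, _, inferInstance, leftRegularHom x, norm_leftRegular_le x, rfl⟩

/-- Indexing by the seminorms instead of the representations keeps the index type in `Type u` and
brings `CStarNorm.iSup` into play. -/
lemma maximalNorm_eq_iSup (f : Cc G) :
    maximalNorm f = ⨆ p : RepresentationSeminorm G, p.1 f := by
  rw [maximalNorm, _root_.iSup]
  congr 1
  ext c
  constructor
  · rintro ⟨H, i1, i2, i3, π, hπ, rfl⟩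
    exact ⟨⟨fun f => ‖π f‖, H, i1, i2, i3, π, hπ, rfl⟩, rfl⟩
  · rintro ⟨⟨p, H, i1, i2, i3, π, hπ, rfl⟩, rfl⟩
    exact ⟨H, i1, i2, i3, π, hπ, rfl⟩

variable (G) in
/-- The maximal norm as a `C*`-norm. -/
noncomputable def maximalCStarNorm : CStarNorm G :=
  .iSup (p := fun p : RepresentationSeminorm G => p.1) (fun p => p.isCStarSeminorm) fun f hf =>
    eq_zero_of_forall_leftRegular f fun x => hf (.ofUnit x)

lemma maximalCStarNorm_apply (f : Cc G) : maximalCStarNorm G f = maximalNorm f :=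
  (maximalNorm_eq_iSup f).symm

lemma dominatesReduced_reducedCStarNorm : (reducedCStarNorm G).DominatesReduced :=
  fun f => (reducedCStarNorm_apply f).ge

lemma dominatesReduced_maximalCStarNorm : (maximalCStarNorm G).DominatesReduced := fun f => by
  have hb : BddAbove (Set.range fun p : RepresentationSeminorm G => p.1 f) :=
    ⟨iNorm f, by rintro _ ⟨p, rfl⟩; exact p.isCStarSeminorm.le_iNorm f⟩
  rw [maximalCStarNorm_apply, maximalNorm_eq_iSup]
  exact Real.iSup_le (fun x => le_ciSup hb (.ofUnit x))
    (Real.iSup_nonneg fun p => p.isCStarSeminorm.nonneg f)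

end SupNorm

/-! ### From invariant measures to tracial states -/

section TraceOfMeasure

open MeasureTheory Cc

variable {G : Type u} [TopologicalSpace G] [GroupoidStructure G] [EtaleGroupoid G] [T2Space G]

lemma norm_integral_res_le [MeasurableSpace G] {ν : CStarNorm G} (hν : ν.DominatesReduced)
    (μ : Measure (UnitSpace G)) [IsProbabilityMeasure μ] (f : Cc G) :
    ‖∫ x, res f x ∂μ‖ ≤ ν f := by
  have := norm_integral_le_of_norm_le_const (μ := μ) (f := fun x => res f x) (C := ν f)
    (.of_forall fun x => (norm_apply_le_reducedNorm f x).trans (hν f))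
  simpa using this

variable [CompactSpace (UnitSpace G)] (ν : CStarNorm G)

/-- The embedding of `C_c(G)` into `C*_ν(G)` as a `*`-homomorphism. -/
noncomputable def CStarNorm.embed : Cc G →⋆ₐ[ℂ] ν.Completion where
  toFun f := UniformSpace.Completion.coe' (α := ν.Alg) f
  map_one' := UniformSpace.Completion.coe_one ν.Alg
  map_mul' f g := UniformSpace.Completion.coe_mul (α := ν.Alg) f g
  map_zero' := UniformSpace.Completion.coe_zero (α := ν.Alg)
  map_add' f g := UniformSpace.Completion.coe_add (α := ν.Alg) f g
  commutes' _ := rfl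
  map_star' f := completion_coe_star (A := ν.Alg) f

lemma CStarNorm.norm_embed (f : Cc G) : ‖ν.embed f‖ = ν f :=
  UniformSpace.Completion.norm_coe (E := ν.Alg) f

lemma CStarNorm.embed_inclusion (f : C(UnitSpace G, ℂ)) :
    ν.embed (inclusion f) = ν.unitFunction f := rfl

lemma CStarNorm.denseRange_embed : DenseRange ν.embed :=
  UniformSpace.Completion.denseRange_coe (α := ν.Alg)

variable [MeasurableSpace G] [BorelSpace G]

/-- Integration of the restriction to the units, as a functional on the normed algebra. -/
noncomputable def traceOnAlg {ν : CStarNorm G} (hν : ν.DominatesReduced)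
    (μ : Measure (UnitSpace G)) [IsProbabilityMeasure μ] : ν.Alg →L[ℂ] ℂ :=
  LinearMap.mkContinuous
    { toFun := fun f : Cc G => ∫ x, res f x ∂μ
      map_add' := fun f g => (integralHom μ).map_add (res f) (res g)
      map_smul' := fun c f => integral_smul c (fun x => res f x) }
    1 fun f => by
      rw [one_mul]
      exact norm_integral_res_le hν μ f

/-- The extension to `C*_ν(G)` of the integration of the restriction to the units. -/
noncomputable def traceOfMeasure {ν : CStarNorm G} (hν : ν.DominatesReduced)
    (μ : Measure (UnitSpace G)) [IsProbabilityMeasure μ] : WeakDual ℂ ν.Completion :=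
  StrongDual.toWeakDual
    ((traceOnAlg hν μ).extend (UniformSpace.Completion.toComplL (𝕜 := ℂ) (E := ν.Alg)))

section

variable {ν} (hν : ν.DominatesReduced) (μ : Measure (UnitSpace G)) [IsProbabilityMeasure μ]

lemma traceOfMeasure_embed (f : Cc G) :
    traceOfMeasure hν μ (ν.embed f) = ∫ x, res f x ∂μ :=
  ContinuousLinearMap.extend_eq (traceOnAlg hν μ)
    (UniformSpace.Completion.denseRange_coe (α := ν.Alg))
    (UniformSpace.Completion.isUniformInducing_coe ν.Alg) f

lemma norm_traceOfMeasure_le (a : ν.Completion) : ‖traceOfMeasure hν μ a‖ ≤ ‖a‖ := by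
  refine ν.denseRange_embed.induction_on a ?_ fun f => ?_
  · exact isClosed_le (map_continuous (traceOfMeasure hν μ)).norm continuous_norm
  · rw [traceOfMeasure_embed, ν.norm_embed]
    exact norm_integral_res_le hν μ f

/-- Positivity and traciality are closed conditions, so they need checking only on the dense image
of `C_c(G)`; there they are `res_star_mul_nonneg` and the invariance of `μ`. -/
lemma traceOfMeasure_mem_tracialStates [LocallyCompactSpace G] [μ.Regular]
    (hμ : IsInvariantMeasure μ) : traceOfMeasure hν μ ∈ tracialStates ν.Completion := by
  have hc := map_continuous (traceOfMeasure hν μ)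
  refine ⟨fun a => ?_, ?_, fun a b => ?_⟩
  · refine ν.denseRange_embed.induction_on a ?_ fun f => ?_
    · exact isClosed_le continuous_const
        (hc.comp ((completion_continuous_star (A := ν.Alg)).mul continuous_id))
    · rw [← map_star, ← map_mul, traceOfMeasure_embed]
      exact integral_nonneg (res_star_mul_nonneg f)
  · rw [← map_one ν.embed, traceOfMeasure_embed]
    have h : ∀ x, res (1 : Cc G) x = 1 := fun x => inclusion_apply 1 x
    simp [h]
  · refine ν.denseRange_embed.induction_on₂ (p := fun a b => traceOfMeasure hν μ (a * b) =
      traceOfMeasure hν μ (b * a)) ?_ (fun f g => ?_) a b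
    · exact isClosed_eq (hc.comp continuous_mul) (hc.comp (continuous_snd.mul continuous_fst))
    · rw [← map_mul, ← map_mul, traceOfMeasure_embed, traceOfMeasure_embed,
        integral_res_mul_comm hμ]

lemma traceOfMeasure_unitFunction (f : C(UnitSpace G, ℂ)) :
    traceOfMeasure hν μ (ν.unitFunction f) = ∫ x, f x ∂μ := by
  rw [← ν.embed_inclusion, traceOfMeasure_embed, res_inclusion]

end

end TraceOfMeasure

/-! ### Hermitian symmetry and Cauchy–Schwarz for tracial states -/

section TracialStates

variable {A : Type*} [CStarAlgebra A] {τ : WeakDual ℂ A}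

lemma convex_tracialStates (A : Type*) [CStarAlgebra A] : Convex ℝ (tracialStates A) := by
  intro σ hσ τ hτ a b ha hb hab
  have h : ∀ x, (a • σ + b • τ) x = (a : ℂ) * σ x + (b : ℂ) * τ x := fun x => rfl
  refine ⟨fun x => ?_, ?_, fun x y => ?_⟩
  · rw [h]
    exact add_nonneg (mul_nonneg (by exact_mod_cast ha) (hσ.1 x))
      (mul_nonneg (by exact_mod_cast hb) (hτ.1 x))
  · rw [h, hσ.2.1, hτ.2.1, mul_one, mul_one]
    exact_mod_cast hab
  · rw [h, h, hσ.2.2, hτ.2.2]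

/-- Polarisation: the value at `(1 + c a)* (1 + c a)` is real, and so are its contributions from `1`
and `a* a`; hence the cross terms are real for every scalar `c`. -/
lemma tracialStates_map_star (hτ : τ ∈ tracialStates A) (a : A) : τ (star a) = star (τ a) := by
  have key : ∀ c : ℂ, (c * τ a + star c * τ (star a)).im = 0 := by
    intro c
    have h1 := (Complex.le_def.1 (hτ.1 (1 + c • a))).2
    have h2 := (Complex.le_def.1 (hτ.1 a)).2
    have e : star (1 + c • a) * (1 + c • a) =
        1 + (c • a + star c • star a) + (star c * c) • (star a * a) := by
      rw [star_add, star_one, star_smul, add_mul, mul_add, mul_add, one_mul, one_mul, mul_one,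
        smul_mul_smul_comm]
      abel
    rw [e, map_add, map_add, map_add, map_smul, map_smul, map_smul, hτ.2.1] at h1
    simp only [Complex.zero_im, smul_eq_mul] at h1 h2
    have h3 : (star c * c * τ (star a * a)).im = 0 := by
      rw [show star c * c = ((Complex.normSq c : ℝ) : ℂ) from Complex.normSq_eq_conj_mul_self.symm,
        Complex.im_ofReal_mul, ← h2, mul_zero]
    rw [Complex.add_im, h3, Complex.add_im] at h1
    simpa using h1.symm
  -- The scalar `1` compares the imaginary parts, the scalar `I` the real parts.
  have h1 := key 1
  have hI := key Complex.I
  apply Complex.ext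
  · simp at hI ⊢; linarith
  · simp at h1 ⊢; linarith

/-- The Cauchy–Schwarz inequality. -/
lemma tracialStates_cauchy_schwarz (hτ : τ ∈ tracialStates A) (a b : A) :
    ‖τ (star a * b)‖ ^ 2 ≤ (τ (star a * a)).re * (τ (star b * b)).re := by
  -- The form is only semidefinite, as the trace may fail to be faithful; Cauchy–Schwarz still
  -- holds.
  let c : PreInnerProductSpace.Core ℂ A :=
    { inner := fun a b => τ (star a * b)
      conj_inner_symm := fun a b => by
        show star (τ (star b * a)) = τ (star a * b)
        rw [← tracialStates_map_star hτ, star_mul, star_star]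
      re_inner_nonneg := fun a => (Complex.le_def.1 (hτ.1 a)).1
      add_left := fun a b c => by
        show τ (star (a + b) * c) = _
        rw [star_add, add_mul, map_add]
      smul_left := fun a b r => by
        show τ (star (r • a) * b) = star r * τ (star a * b)
        rw [star_smul, smul_mul_assoc, map_smul, smul_eq_mul] }
  have h := @InnerProductSpace.Core.inner_mul_inner_self_le ℂ A _ _ _ c a b
  have h2 : ‖τ (star b * a)‖ = ‖τ (star a * b)‖ := by
    rw [← norm_star, ← tracialStates_map_star hτ, star_mul, star_star]
  have h' : ‖τ (star a * b)‖ * ‖τ (star b * a)‖ ≤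
    (τ (star a * a)).re * (τ (star b * b)).re := h
  rwa [h2, ← sq] at h'

end TracialStates

/-! ### From tracial states to invariant measures -/

section MeasureOfTrace

open MeasureTheory Cc

section

variable {X : Type*} [TopologicalSpace X]

/-- A real function, as a complex one. -/
noncomputable def ofRealMap (f : C(X, ℝ)) : C(X, ℂ) :=
  ⟨fun x => (f x : ℂ), by fun_prop⟩

lemma ofRealMap_apply (f : C(X, ℝ)) (x : X) :
    ofRealMap f x = (f x : ℂ) := rfl

lemma ext_of_integral_continuousMap [CompactSpace X] [T2Space X] [MeasurableSpace X] [BorelSpace X]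
    {μ μ' : Measure X} [μ.Regular] [μ'.Regular]
    (h : ∀ f : C(X, ℂ), ∫ x, f x ∂μ = ∫ x, f x ∂μ') : μ = μ' := by
  refine Measure.ext_of_integral_eq_on_compactlySupported fun f => ?_
  have h1 : ∫ x, (f x : ℂ) ∂μ = ∫ x, (f x : ℂ) ∂μ' := h (ofRealMap f.toContinuousMap)
  rw [integral_complex_ofReal, integral_complex_ofReal] at h1
  exact_mod_cast h1

end

variable {G : Type u} [TopologicalSpace G] [GroupoidStructure G] [EtaleGroupoid G] [T2Space G]
  [CompactSpace (UnitSpace G)] {ν : CStarNorm G} {τ : WeakDual ℂ ν.Completion}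

/-- The embedding of the functions on the unit space into `C*_ν(G)` as a `*`-homomorphism. -/
noncomputable def CStarNorm.unitHom (ν : CStarNorm G) : C(UnitSpace G, ℂ) →⋆ₐ[ℂ] ν.Completion :=
  ν.embed.comp inclusionHom

lemma CStarNorm.unitHom_apply (f : C(UnitSpace G, ℂ)) : ν.unitHom f = ν.unitFunction f := rfl

/-- A nonnegative function is `g* g` for `g` its square root. -/
lemma unitHom_ofRealMap_nonneg (hτ : τ ∈ tracialStates ν.Completion) {f : C(UnitSpace G, ℝ)}
    (hf : ∀ x, 0 ≤ f x) : 0 ≤ τ (ν.unitHom (ofRealMap f)) := by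
  let g : C(UnitSpace G, ℝ) := ⟨fun x => √(f x), by fun_prop⟩
  have h : ofRealMap f = star (ofRealMap g) * ofRealMap g := by
    ext x
    rw [ContinuousMap.mul_apply, ContinuousMap.star_apply, ofRealMap_apply, ofRealMap_apply]
    show (f x : ℂ) = star ((√(f x) : ℝ) : ℂ) * ((√(f x) : ℝ) : ℂ)
    rw [RCLike.star_def, Complex.conj_ofReal, ← Complex.ofReal_mul, Real.mul_self_sqrt (hf x)]
  rw [h, map_mul, map_star]
  exact hτ.1 _

lemma im_unitHom_ofRealMap (hτ : τ ∈ tracialStates ν.Completion) (f : C(UnitSpace G, ℝ)) :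
    (τ (ν.unitHom (ofRealMap f))).im = 0 := by
  have h : star (ofRealMap f) = ofRealMap f := by
    ext x
    rw [ContinuousMap.star_apply, ofRealMap_apply, RCLike.star_def, Complex.conj_ofReal]
  have h1 := tracialStates_map_star hτ (ν.unitHom (ofRealMap f))
  rw [← map_star, h] at h1
  exact Complex.conj_eq_iff_im.1 h1.symm

/-- A tracial state vanishes at the functions supported in arrows with different source and
range. -/
lemma tracialStates_eq_zero_of_s_ne_r [LocallyCompactSpace G] (hτ : τ ∈ tracialStates ν.Completion) (f : Cc G)
    (hf : ∀ γ ∈ tsupport f, s γ ≠ r γ) : τ (ν.embed f) = 0 := by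
  let L : Cc G →+ ℂ := (τ : ν.Completion →+ ℂ).comp (ν.embed : Cc G →+ ν.Completion)
  refine show L f = 0 from eq_zero_of_locally L f fun γ hγ => ?_
  -- The cutoff `e` is `0` near the source and `1` near the range. For `g` supported close to `γ`
  -- this gives `e g = g` and `g e = 0`, and the trace identifies the two.
  obtain ⟨V, hsV, hVo, W, hrW, hWo, hd⟩ := exists_open_nhds_disjoint_closure (hf γ hγ)
  obtain ⟨e, he0, he1, -⟩ := exists_continuous_zero_one_of_isClosed isClosed_closure
    isClosed_closure hd
  refine ⟨s ⁻¹' V ∩ r ⁻¹' W, Filter.inter_mem ((hVo.preimage continuous_s).mem_nhds hsV)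
    ((hWo.preimage continuous_r).mem_nhds hrW), fun g hg _ => ?_⟩
  have hg' := (subset_tsupport g).trans hg
  have h1 : inclusion (ofRealMap e) * g = g := coe_inj (funext fun γ => by
    rw [inclusion_mul]
    by_cases hγ : g γ = 0
    · rw [hγ, mul_zero]
    · rw [ofRealMap_apply, he1 (subset_closure (hg' hγ).2)]; simp)
  have h2 : g * inclusion (ofRealMap e) = 0 := coe_inj (funext fun γ => by
    rw [mul_inclusion]
    by_cases hγ : g γ = 0
    · rw [hγ, zero_mul]; rfl
    · rw [ofRealMap_apply, he0 (subset_closure (hg' hγ).1)]; simp)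
  show τ (ν.embed g) = 0
  rw [← h1, map_mul, hτ.2.2, ← map_mul, h2, map_zero, map_zero]

variable [MeasurableSpace G] [BorelSpace G]

/-- The positive functional on the real functions on the unit space given by a tracial state. -/
noncomputable def realFunctional (hτ : τ ∈ tracialStates ν.Completion) :
    C_c(UnitSpace G, ℝ) →ₚ[ℝ] ℝ :=
  PositiveLinearMap.mk₀
    { toFun := fun f => (τ (ν.unitHom (ofRealMap f.toContinuousMap))).re
      map_add' := fun f g => by
        have h : ofRealMap (f + g).toContinuousMap =
            ofRealMap f.toContinuousMap + ofRealMap g.toContinuousMap := by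
          ext x; exact Complex.ofReal_add (f x) (g x)
        rw [h, map_add, map_add, Complex.add_re]
      map_smul' := fun c f => by
        have h : ofRealMap (c • f).toContinuousMap =
            (c : ℂ) • ofRealMap f.toContinuousMap := by
          ext x; exact Complex.ofReal_mul c (f x)
        rw [h, map_smul, map_smul, smul_eq_mul, Complex.re_ofReal_mul]
        rfl }
    fun f hf => (Complex.le_def.1 (unitHom_ofRealMap_nonneg hτ (f := f.toContinuousMap) hf)).1

/-- The Riesz representation of a tracial state on the unit space. -/
lemma exists_isAssociatedMeasure (hτ : τ ∈ tracialStates ν.Completion) :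
    ∃ μ : FiniteMeasure (UnitSpace G), IsAssociatedMeasure τ μ := by
  let m := RealRMK.rieszMeasure (realFunctional hτ)
  have hfin : IsFiniteMeasure m := inferInstance
  have hreg : m.Regular := inferInstance
  have hreal : ∀ f : C(UnitSpace G, ℝ), τ (ν.unitHom (ofRealMap f)) = ((∫ x, f x ∂m : ℝ) : ℂ) := by
    intro f
    have h := RealRMK.integral_rieszMeasure (realFunctional hτ)
      ⟨f, HasCompactSupport.of_compactSpace _⟩
    have h' : ∫ x, f x ∂m = (τ (ν.unitHom (ofRealMap f))).re := h
    apply Complex.ext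
    · rw [h', Complex.ofReal_re]
    · rw [im_unitHom_ofRealMap hτ, Complex.ofReal_im]
  have hcomplex : ∀ f : C(UnitSpace G, ℂ), τ (ν.unitHom f) = ∫ x, f x ∂m := by
    intro f
    let u : C(UnitSpace G, ℝ) := ⟨fun x => (f x).re, by fun_prop⟩
    let v : C(UnitSpace G, ℝ) := ⟨fun x => (f x).im, by fun_prop⟩
    have hf : f = ofRealMap u + Complex.I • ofRealMap v := by
      ext x
      show f x = ((f x).re : ℂ) + Complex.I * ((f x).im : ℂ)
      rw [mul_comm, Complex.re_add_im]
    have e : ∀ w : C(UnitSpace G, ℝ), ((∫ x, w x ∂m : ℝ) : ℂ) = ∫ x, ofRealMap w x ∂m := fun w =>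
      integral_complex_ofReal.symm
    have e2 : ∫ x, (ofRealMap u + Complex.I • ofRealMap v) x ∂m =
        ∫ x, ofRealMap u x ∂m + Complex.I * ∫ x, ofRealMap v x ∂m :=
      ((integralHom m).map_add _ _).trans
        (congrArg₂ _ rfl (integral_smul Complex.I fun x => ofRealMap v x))
    rw [hf, e2, map_add, map_add, map_smul, map_smul, hreal, hreal, e, e, smul_eq_mul]
  -- The total mass is the value of the trace at the constant function `1`, the identity of the
  -- algebra.
  have hprob : IsProbabilityMeasure m := by
    have h1 := hreal 1
    have h2 : ofRealMap (1 : C(UnitSpace G, ℝ)) = 1 := by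
      ext x; simp [ofRealMap_apply]
    rw [h2, map_one, hτ.2.1] at h1
    have h3 : ∫ x, (1 : C(UnitSpace G, ℝ)) x ∂m = m.real Set.univ := by simp
    rw [h3] at h1
    have h4 : m.real Set.univ = 1 := by exact_mod_cast h1.symm
    exact ⟨by rwa [measureReal_def, ENNReal.toReal_eq_one_iff] at h4⟩
  exact ⟨⟨m, hfin⟩, hprob, hreg, hcomplex⟩

lemma IsAssociatedMeasure.unique {μ μ' : FiniteMeasure (UnitSpace G)}
    (h : IsAssociatedMeasure τ μ) (h' : IsAssociatedMeasure τ μ') : μ = μ' := by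
  have hμ : (μ : Measure (UnitSpace G)).Regular := h.2.1
  have hμ' : (μ' : Measure (UnitSpace G)).Regular := h'.2.1
  have e : (μ : Measure (UnitSpace G)) = μ' :=
    ext_of_integral_continuousMap fun f => (h.2.2 f).symm.trans (h'.2.2 f)
  exact Subtype.ext e

/-- The left side is the integral of `e²`, which lies below the indicator of `U`. It bounds the
second factor in the Cauchy–Schwarz estimate below. -/
lemma IsAssociatedMeasure.re_star_mul_self_le {μ : FiniteMeasure (UnitSpace G)}
    (h : IsAssociatedMeasure τ μ) (e : C(UnitSpace G, ℝ)) {U : Set (UnitSpace G)} (hU : IsOpen U)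
    (he : ∀ x, e x ∈ Set.Icc (0 : ℝ) 1) (heU : ∀ x ∉ U, e x = 0) :
    (τ (star (ν.embed (inclusion (ofRealMap e))) * ν.embed (inclusion (ofRealMap e)))).re ≤
      (μ : Measure (UnitSpace G)).real U := by
  have h0 : star (ν.embed (inclusion (ofRealMap e))) * ν.embed (inclusion (ofRealMap e)) =
      ν.unitFunction (ofRealMap (e * e)) := by
    rw [ν.embed_inclusion, ← ν.unitHom_apply, ← map_star, ← map_mul, ← ν.unitHom_apply]
    congr 1
    ext x
    rw [ContinuousMap.mul_apply, ContinuousMap.star_apply, ofRealMap_apply, ofRealMap_apply,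
      RCLike.star_def, Complex.conj_ofReal, ContinuousMap.mul_apply, Complex.ofReal_mul]
  have h1 : ∫ x, ofRealMap (e * e) x ∂(μ : Measure (UnitSpace G)) =
      ((∫ x, e x * e x ∂(μ : Measure (UnitSpace G)) : ℝ) : ℂ) := integral_complex_ofReal
  rw [h0, h.2.2, h1, Complex.ofReal_re, ← integral_indicator_one hU.measurableSet]
  refine integral_mono_of_nonneg (.of_forall fun x => mul_self_nonneg _)
    ((integrable_const 1).indicator hU.measurableSet) (.of_forall fun x => ?_)
  by_cases hx : x ∈ U
  · simp only [Set.indicator_of_mem hx, Pi.one_apply]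
    exact mul_le_one₀ (he x).2 (he x).1 (he x).2
  · simp only [Set.indicator_of_notMem hx, heU x hx, mul_zero, le_refl]

variable [LocallyCompactSpace G]

/-- For `g` supported in a bisection and a cutoff `b` that is `1` on its support, `b* g` and `g b*`
are functions on the units, namely the source and range fibre sums of `g`. The trace property
equates their integrals. -/
lemma IsAssociatedMeasure.isInvariantMeasure (hτ : τ ∈ tracialStates ν.Completion)
    {μ : FiniteMeasure (UnitSpace G)} (h : IsAssociatedMeasure τ μ) :
    IsInvariantMeasure (μ : Measure (UnitSpace G)) := by
  have := h.2.1
  refine (isInvariantMeasure_iff_integral _).2 fun k => ?_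
  let L : Cc G →+ ℂ := (integralHom (μ : Measure (UnitSpace G))).comp (pushS G) -
    (integralHom (μ : Measure (UnitSpace G))).comp (pushR G)
  refine sub_eq_zero.1 (show L k = 0 from eq_zero_of_locally L k fun γ _ => ?_)
  obtain ⟨B, ho, hγ, hB⟩ := exists_bisection_mem_nhds γ
  refine ⟨B, ho.mem_nhds hγ, fun g hg _ => sub_eq_zero.2 ?_⟩
  obtain ⟨φ, hφ1, hφ0, hφc, -⟩ := exists_continuous_one_zero_of_isCompact g.hasCompactSupport
    ho.isClosed_compl (Set.disjoint_compl_right_iff_subset.2 hg)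
  let b : Cc G := .of (ofRealMap φ) (ofRealMap φ).continuous
    (hφc.comp_left (g := fun z : ℝ => (z : ℂ)) (by simp))
  have hb : Function.support b ⊆ B := by
    intro γ hγ
    by_contra hγB
    exact hγ (by show ((φ γ : ℝ) : ℂ) = 0; rw [hφ0 hγB]; simp)
  have hg' := (subset_tsupport g).trans hg
  -- At `α` the left side is the conjugate of `b α` times `g α`, and `b = 1` wherever `g` is
  -- nonzero.
  have e : diag (star b) g = g := by
    refine coe_inj (funext fun γ => ?_)
    rw [diag_star]
    by_cases hγ : γ ∈ tsupport g
    · have : b γ = 1 := by show ((φ γ : ℝ) : ℂ) = 1; rw [hφ1 hγ]; simp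
      rw [this, star_one, one_mul]
    · rw [image_eq_zero_of_notMem_tsupport hγ, mul_zero]
  have e1 : star b * g = inclusion (pushS G g) := by
    rw [eq_inclusion_res (f := star b * g) fun γ hγ => star_mul_apply_eq_zero hB.injOn_r hb hg' hγ,
      res_mul_eq_pushS, e]
  have e2 : g * star b = inclusion (pushR G g) := by
    rw [eq_inclusion_res (f := g * star b) fun γ hγ => mul_star_apply_eq_zero hB.injOn_s hg' hb hγ,
      res_mul_eq_pushR, e]
  have h1 := hτ.2.2 (ν.embed (star b)) (ν.embed g)
  rw [← map_mul, ← map_mul, e1, e2, ν.embed_inclusion, ν.embed_inclusion, h.2.2, h.2.2] at h1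
  exact h1

/-! ### Essential freeness -/

/-- A tracial state vanishes at the functions supported in a bisection whose fixed points form
a null set. -/
lemma IsAssociatedMeasure.eq_zero_of_fixedPoints (hτ : τ ∈ tracialStates ν.Completion)
    {μ : FiniteMeasure (UnitSpace G)} (h : IsAssociatedMeasure τ μ) {B : Set G}
    (hB : IsBisection B) (hfix : (μ : Measure (UnitSpace G)) (fixedPoints hB) = 0) (f : Cc G)
    (hf : tsupport f ⊆ B) : τ (ν.embed f) = 0 := by
  have := h.2.1
  -- The base points of the isotropy arrows in the support of `f`: a compact subset of the fixed
  -- points, hence a null set.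
  set F : Set (UnitSpace G) := s '' (tsupport f ∩ {γ | s γ = r γ}) with hF
  have hFc : IsCompact F := (f.hasCompactSupport.inter_right
    (isClosed_eq continuous_s continuous_r)).image continuous_s
  have hF0 : (μ : Measure (UnitSpace G)) F = 0 := by
    refine measure_mono_null ?_ hfix
    rintro _ ⟨γ, ⟨hγ, hsr⟩, rfl⟩
    refine ⟨⟨γ, hf hγ, rfl⟩, ?_⟩
    exact (bisectionHomeo_apply hB (hf hγ) ⟨γ, hf hγ, rfl⟩).trans (Eq.symm hsr)
  set C : ℝ := (τ (star (ν.embed (star f)) * ν.embed (star f))).re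
  have hC : 0 ≤ C := (Complex.le_def.1 (hτ.1 _)).1
  have key : ∀ ε : ℝ, 0 < ε → ‖τ (ν.embed f)‖ ^ 2 ≤ C * ε := by
    intro ε hε
    -- Outer regularity encloses `F` in an open set of measure below `ε`; the cutoff `e` is `1` near
    -- `F` and `0` off `U`.
    obtain ⟨U, hFU, hUo, hUε⟩ := F.exists_isOpen_lt_of_lt (μ := (μ : Measure (UnitSpace G)))
      (ENNReal.ofReal ε) (by rw [hF0]; exact ENNReal.ofReal_pos.2 hε)
    obtain ⟨V, hVo, hFV, hVU⟩ := normal_exists_closure_subset hFc.isClosed hUo hFU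
    obtain ⟨e, he0, he1, he⟩ := exists_continuous_zero_one_of_isClosed hUo.isClosed_compl
      isClosed_closure (Set.disjoint_compl_left_iff_subset.2 hVU)
    -- The support of this product stays away from the sources in `V`, and any isotropy arrow in the
    -- support of `f` has its source in `F ⊆ V`. So source and range differ throughout.
    have h1 : τ (ν.embed (f * inclusion (ofRealMap (1 - e)))) = 0 := by
      refine tracialStates_eq_zero_of_s_ne_r hτ _ fun γ hγ hsr => ?_
      have hsub : Function.support (f * inclusion (ofRealMap (1 - e)) : Cc G) ⊆
          tsupport f ∩ s ⁻¹' Vᶜ := by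
        intro γ hγ
        have hγ' : f γ * ofRealMap (1 - e) (s γ) ≠ 0 := by rwa [← mul_inclusion]
        refine ⟨subset_tsupport f (left_ne_zero_of_mul hγ'), fun hV => ?_⟩
        apply right_ne_zero_of_mul hγ'
        rw [ofRealMap_apply, ContinuousMap.sub_apply, he1 (subset_closure hV)]
        simp
      have hγ' := closure_minimal hsub ((isClosed_tsupport f).inter
        (hVo.isClosed_compl.preimage continuous_s)) hγ
      exact hγ'.2 (hFV ⟨γ, ⟨hγ'.1, hsr⟩, rfl⟩)
    have h2 : f = f * inclusion (ofRealMap e) + f * inclusion (ofRealMap (1 - e)) :=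
      coe_inj (funext fun γ => by
        rw [coe_add, Pi.add_apply, mul_inclusion, mul_inclusion, ofRealMap_apply, ofRealMap_apply,
          ContinuousMap.sub_apply, ContinuousMap.one_apply]
        push_cast
        ring)
    -- Only `f e` survives; written as `(f*)* e` it is the pairing of `f*` with `e`, ready for
    -- Cauchy–Schwarz.
    have h3 : τ (ν.embed f) =
        τ (star (ν.embed (star f)) * ν.embed (inclusion (ofRealMap e))) := by
      rw [h2, map_add, map_add, h1, add_zero, ← map_star, star_star, ← map_mul, ← h2]
    rw [h3]
    refine (tracialStates_cauchy_schwarz hτ _ _).trans (mul_le_mul_of_nonneg_left ?_ hC)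
    refine (h.re_star_mul_self_le e hUo he fun x hx => he0 hx).trans ?_
    exact ENNReal.toReal_le_of_le_ofReal hε.le hUε.le
  have h0 : ‖τ (ν.embed f)‖ ^ 2 ≤ 0 := by
    refine le_of_forall_pos_le_add fun δ hδ => ?_
    -- The denominator `C + 1` stays positive even when `C = 0`.
    refine (key (δ / (C + 1)) (by positivity)).trans ?_
    rw [zero_add, mul_div_assoc', div_le_iff₀ (by positivity)]
    nlinarith
  exact norm_eq_zero.1 (pow_eq_zero_iff two_ne_zero |>.1 (le_antisymm h0 (sq_nonneg _)))

/-- For an essentially free groupoid, a tracial state is determined by its restriction to the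
functions on the unit space. -/
lemma IsAssociatedMeasure.embed_eq (hτ : τ ∈ tracialStates ν.Completion)
    {μ : FiniteMeasure (UnitSpace G)} (h : IsAssociatedMeasure τ μ)
    (hfree : EssentiallyFreeFor (μ : Measure (UnitSpace G))) (f : Cc G) :
    τ (ν.embed f) = ∫ x, res f x ∂(μ : Measure (UnitSpace G)) := by
  let g : Cc G := f - inclusion (res f)
  have hg : ∀ γ ∈ units G, g γ = 0 := fun γ hγ => by
    have h1 : g γ = f γ - inclusion (res f) γ := rfl
    rw [h1, inclusion_apply (res f) ⟨γ, hγ⟩, res_apply, sub_self]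
  have hg0 : τ (ν.embed g) = 0 := by
    let L : Cc G →+ ℂ := (τ : ν.Completion →+ ℂ).comp (ν.embed : Cc G →+ ν.Completion)
    refine show L g = 0 from eq_zero_of_locally L g fun γ hγ => ?_
    -- The units are open, so a function vanishing on them has its closed support off the units.
    have hγu : γ ∉ units G := fun hu => by
      obtain ⟨δ, hδu, hδ⟩ := mem_closure_iff.1 hγ _ isOpen_units hu
      exact hδ (hg δ hδu)
    obtain ⟨B, ho, hγB, hB⟩ := exists_bisection_mem_nhds γ
    obtain ⟨K, hK, hγK⟩ := exists_compact_mem_nhds γ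
    -- Shrinking the bisection away from the units and into a compact set makes essential freeness
    -- applicable to it.
    have hB'o : IsOpen (B ∩ (units G)ᶜ ∩ interior K) :=
      (ho.inter isClosed_units.isOpen_compl).inter isOpen_interior
    have hsub : B ∩ (units G)ᶜ ∩ interior K ⊆ B := fun x hx => hx.1.1
    have hB' : IsBisection (B ∩ (units G)ᶜ ∩ interior K) :=
      .of_injOn hB'o (hB.injOn_s.mono hsub) (hB.injOn_r.mono hsub)
    refine ⟨_, hB'o.mem_nhds ⟨⟨hγB, hγu⟩, mem_interior_iff_mem_nhds.2 hγK⟩, fun k hk _ => ?_⟩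
    refine h.eq_zero_of_fixedPoints hτ hB' (hfree _ hB' hB'o ?_ ?_) k hk
    · exact hK.of_isClosed_subset isClosed_closure
        (closure_minimal (Set.inter_subset_right.trans interior_subset) hK.isClosed)
    · exact Set.disjoint_left.2 fun x hx => hx.1.2
  have hf : f = g + inclusion (res f) := (sub_add_cancel _ _).symm
  rw [← h.2.2, ← ν.embed_inclusion]
  conv_lhs => rw [hf, map_add, map_add, hg0, zero_add]

end MeasureOfTrace

/-! ### The affine homeomorphism and the extreme points -/

section Homeomorphism

open MeasureTheory Cc

variable {G : Type u} [TopologicalSpace G] [GroupoidStructure G] [CompactSpace (UnitSpace G)]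
  [MeasurableSpace G] [BorelSpace G]

lemma integral_smul_add_smul (μ μ' : FiniteMeasure (UnitSpace G)) (a b : ℝ≥0)
    (f : C(UnitSpace G, ℂ)) :
    ∫ x, f x ∂((a • μ + b • μ' : FiniteMeasure (UnitSpace G)) : Measure (UnitSpace G)) =
      (a : ℂ) * ∫ x, f x ∂(μ : Measure (UnitSpace G)) +
        (b : ℂ) * ∫ x, f x ∂(μ' : Measure (UnitSpace G)) := by
  rw [FiniteMeasure.toMeasure_add, FiniteMeasure.toMeasure_smul, FiniteMeasure.toMeasure_smul,
    integral_add_measure (integrable_continuousMap (a • (μ : Measure (UnitSpace G))) f)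
      (integrable_continuousMap (b • (μ' : Measure (UnitSpace G))) f),
    integral_smul_nnreal_measure, integral_smul_nnreal_measure]
  rfl

variable [EtaleGroupoid G] [T2Space G] [LocallyCompactSpace G]

variable (G) in
-- The fibre-sum criterion for invariance is linear in the measure.
lemma convex_invariantMeasures : Convex ℝ≥0 (invariantMeasures G) := by
  intro μ hμ μ' hμ' a b _ _ hab
  obtain ⟨h1, h2, h3⟩ := hμ
  obtain ⟨h1', h2', h3'⟩ := hμ'
  have hreg : ((a • μ + b • μ' : FiniteMeasure (UnitSpace G)) : Measure (UnitSpace G)).Regular := by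
    rw [FiniteMeasure.toMeasure_add, FiniteMeasure.toMeasure_smul, FiniteMeasure.toMeasure_smul]
    infer_instance
  refine ⟨⟨?_⟩, hreg, ?_⟩
  · rw [FiniteMeasure.toMeasure_add, FiniteMeasure.toMeasure_smul, FiniteMeasure.toMeasure_smul]
    simp only [Measure.add_apply, Measure.smul_apply, measure_univ]
    simp only [ENNReal.smul_def, smul_eq_mul, mul_one]
    exact_mod_cast hab
  · refine (isInvariantMeasure_iff_integral _).2 fun k => ?_
    rw [integral_smul_add_smul, integral_smul_add_smul, (isInvariantMeasure_iff_integral _).1 h3,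
      (isInvariantMeasure_iff_integral _).1 h3']

variable {ν : CStarNorm G}

/-- The invariant measure associated with a tracial state. -/
noncomputable def associatedMeasure (τ : tracialStates ν.Completion) : invariantMeasures G :=
  ⟨(exists_isAssociatedMeasure τ.2).choose,
    (exists_isAssociatedMeasure τ.2).choose_spec.1, (exists_isAssociatedMeasure τ.2).choose_spec.2.1,
    (exists_isAssociatedMeasure τ.2).choose_spec.isInvariantMeasure τ.2⟩

lemma isAssociatedMeasure_associatedMeasure (τ : tracialStates ν.Completion) :
    IsAssociatedMeasure τ.1 (associatedMeasure τ).1 :=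
  (exists_isAssociatedMeasure τ.2).choose_spec

/-- The tracial state given by an invariant measure. -/
noncomputable def traceOfInvariantMeasure (hν : ν.DominatesReduced) (μ : invariantMeasures G) :
    tracialStates ν.Completion :=
  have := μ.2.1
  have := μ.2.2.1
  ⟨traceOfMeasure hν (μ.1 : Measure (UnitSpace G)),
    traceOfMeasure_mem_tracialStates hν _ μ.2.2.2⟩

lemma traceOfInvariantMeasure_embed (hν : ν.DominatesReduced) (μ : invariantMeasures G) (f : Cc G) :
    (traceOfInvariantMeasure hν μ).1 (ν.embed f) = ∫ x, res f x ∂(μ.1 : Measure (UnitSpace G)) :=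
  have := μ.2.1
  traceOfMeasure_embed hν _ f

lemma norm_traceOfInvariantMeasure_le (hν : ν.DominatesReduced) (μ : invariantMeasures G)
    (a : ν.Completion) : ‖(traceOfInvariantMeasure hν μ).1 a‖ ≤ ‖a‖ :=
  have := μ.2.1
  norm_traceOfMeasure_le hν _ a

lemma isAssociatedMeasure_traceOfInvariantMeasure (hν : ν.DominatesReduced)
    (μ : invariantMeasures G) : IsAssociatedMeasure (traceOfInvariantMeasure hν μ).1 μ.1 :=
  have := μ.2.1
  ⟨μ.2.1, μ.2.2.1, traceOfMeasure_unitFunction hν _⟩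

lemma associatedMeasure_traceOfInvariantMeasure (hν : ν.DominatesReduced)
    (μ : invariantMeasures G) : associatedMeasure (traceOfInvariantMeasure hν μ) = μ :=
  Subtype.ext ((isAssociatedMeasure_associatedMeasure _).unique
    (isAssociatedMeasure_traceOfInvariantMeasure hν μ))

/-- By essential freeness both traces integrate the restriction to the units over the same measure
on the dense subalgebra `C_c(G)`. -/
lemma traceOfInvariantMeasure_associatedMeasure (hfree : EssentiallyFree G)
    (hν : ν.DominatesReduced) (τ : tracialStates ν.Completion) :
    traceOfInvariantMeasure hν (associatedMeasure τ) = τ := by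
  refine Subtype.ext (DFunLike.coe_injective (ν.denseRange_embed.equalizer
    (map_continuous (traceOfInvariantMeasure hν (associatedMeasure τ)).1) (map_continuous τ.1)
    (funext fun f => ?_)))
  show (traceOfInvariantMeasure hν (associatedMeasure τ)).1 (ν.embed f) = τ.1 (ν.embed f)
  rw [traceOfInvariantMeasure_embed, (isAssociatedMeasure_associatedMeasure τ).embed_eq τ.2
    (hfree _ (associatedMeasure τ).2)]

/-- Integrals of test functions against the measure are evaluations of the trace at fixed elements,
which are weak-`*` continuous. -/
lemma continuous_associatedMeasure :
    Continuous (associatedMeasure : tracialStates ν.Completion → invariantMeasures G) := by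
  refine continuous_induced_rng.2 (continuous_iff_continuousAt.2 fun τ => ?_)
  refine (FiniteMeasure.tendsto_iff_forall_integral_rclike_tendsto ℂ).2 fun f => ?_
  have h : ∀ σ : tracialStates ν.Completion,
      ∫ x, f x ∂((associatedMeasure σ).1 : Measure (UnitSpace G)) =
        σ.1 (ν.unitFunction f.toContinuousMap) := fun σ =>
    ((isAssociatedMeasure_associatedMeasure σ).2.2 f.toContinuousMap).symm
  have hc : Continuous fun σ : tracialStates ν.Completion =>
      σ.1 (ν.unitFunction f.toContinuousMap) :=
    (WeakDual.eval_continuous _).comp continuous_subtype_val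
  simp_rw [Function.comp_apply, h]
  exact hc.tendsto τ

lemma continuous_traceOfInvariantMeasure (hν : ν.DominatesReduced) :
    Continuous (traceOfInvariantMeasure hν) := by
  refine continuous_induced_rng.2 (WeakDual.continuous_of_continuous_eval fun a => ?_)
  -- For elements of `C_c(G)` continuity in `μ` is the weak topology itself. Since all these traces
  -- are contractive, approximating `a` in norm approximates its evaluation uniformly in `μ`.
  refine continuous_of_uniform_approx_of_continuous fun u hu => ?_
  obtain ⟨ε, hε, hεu⟩ := Metric.mem_uniformity_dist.1 hu
  obtain ⟨f, hf⟩ := Metric.denseRange_iff.1 ν.denseRange_embed a ε hε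
  refine ⟨fun μ => (traceOfInvariantMeasure hν μ).1 (ν.embed f), ?_, fun μ => hεu ?_⟩
  · simp_rw [traceOfInvariantMeasure_embed]
    refine continuous_iff_continuousAt.2 fun μ => ?_
    exact (FiniteMeasure.tendsto_iff_forall_integral_rclike_tendsto ℂ).1
      (continuous_subtype_val.tendsto μ) (BoundedContinuousFunction.mkOfCompact (res f))
  · rw [dist_eq_norm] at hf ⊢
    refine lt_of_le_of_lt ?_ hf
    refine le_trans (le_of_eq ?_) (norm_traceOfInvariantMeasure_le hν μ (a - ν.embed f))
    rw [map_sub]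
    rfl

/-- The homeomorphism between the tracial states and the invariant measures. -/
noncomputable def traceHomeomorph (hfree : EssentiallyFree G) (hν : ν.DominatesReduced) :
    tracialStates ν.Completion ≃ₜ invariantMeasures G where
  toFun := associatedMeasure
  invFun := traceOfInvariantMeasure hν
  left_inv := traceOfInvariantMeasure_associatedMeasure hfree hν
  right_inv := associatedMeasure_traceOfInvariantMeasure hν
  continuous_toFun := continuous_associatedMeasure
  continuous_invFun := continuous_traceOfInvariantMeasure hν

/-- The convex combination of the two measures represents `τ`, so uniqueness of the associated
measure applies. -/
lemma associatedMeasure_affine (τ₁ τ₂ τ : tracialStates ν.Completion) (a b : ℝ≥0)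
    (hab : a + b = 1) (h : τ.1 = (a : ℝ) • τ₁.1 + (b : ℝ) • τ₂.1) :
    (associatedMeasure τ).1 = a • (associatedMeasure τ₁).1 + b • (associatedMeasure τ₂).1 := by
  have hm := convex_invariantMeasures G (associatedMeasure τ₁).2 (associatedMeasure τ₂).2
    zero_le zero_le hab
  refine (isAssociatedMeasure_associatedMeasure τ).unique ⟨hm.1, hm.2.1, fun f => ?_⟩
  rw [integral_smul_add_smul, ← (isAssociatedMeasure_associatedMeasure τ₁).2.2,
    ← (isAssociatedMeasure_associatedMeasure τ₂).2.2, h]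
  rfl

lemma mem_extremePoints_iff_associatedMeasure (hfree : EssentiallyFree G)
    (hν : ν.DominatesReduced) (τ : tracialStates ν.Completion) :
    τ.1 ∈ (tracialStates ν.Completion).extremePoints ℝ ↔
      (associatedMeasure τ).1 ∈ (invariantMeasures G).extremePoints ℝ≥0 := by
  have hinj : ∀ {σ σ' : tracialStates ν.Completion},
      (associatedMeasure σ).1 = (associatedMeasure σ').1 → σ = σ' := fun h =>
    (traceHomeomorph hfree hν).injective (Subtype.ext h)
  rw [mem_extremePoints_iff_left, mem_extremePoints_iff_left]
  constructor
  · rintro ⟨-, h⟩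
    refine ⟨(associatedMeasure τ).2, fun μ₁ h₁ μ₂ h₂ hseg => ?_⟩
    obtain ⟨a, b, ha, hb, hab, heq⟩ := hseg
    obtain ⟨σ₁, hσ₁⟩ := (traceHomeomorph hfree hν).surjective ⟨μ₁, h₁⟩
    obtain ⟨σ₂, hσ₂⟩ := (traceHomeomorph hfree hν).surjective ⟨μ₂, h₂⟩
    have e₁ : (associatedMeasure σ₁).1 = μ₁ := congrArg Subtype.val hσ₁
    have e₂ : (associatedMeasure σ₂).1 = μ₂ := congrArg Subtype.val hσ₂
    have hab' : (a : ℝ) + b = 1 := by exact_mod_cast hab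
    -- The decomposition of the measure lifts to traces; this combination has the same measure as
    -- `τ`, so injectivity identifies it with `τ`.
    let σ : tracialStates ν.Completion := ⟨(a : ℝ) • σ₁.1 + (b : ℝ) • σ₂.1,
      convex_tracialStates _ σ₁.2 σ₂.2 a.2 b.2 hab'⟩
    have hσ : σ = τ := hinj (by
      rw [associatedMeasure_affine σ₁ σ₂ σ a b hab rfl, e₁, e₂, heq])
    have := h σ₁.1 σ₁.2 σ₂.1 σ₂.2
      ⟨a, b, by exact_mod_cast ha, by exact_mod_cast hb, hab', congrArg Subtype.val hσ⟩
    rw [← e₁, show σ₁ = τ from Subtype.ext this]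
  · rintro ⟨-, h⟩
    refine ⟨τ.2, fun τ₁ h₁ τ₂ h₂ hseg => ?_⟩
    obtain ⟨a, b, ha, hb, hab, heq⟩ := hseg
    lift a to ℝ≥0 using ha.le
    lift b to ℝ≥0 using hb.le
    have hab' : a + b = 1 := by exact_mod_cast hab
    have := h _ (associatedMeasure ⟨τ₁, h₁⟩).2 _ (associatedMeasure ⟨τ₂, h₂⟩).2
      ⟨a, b, by exact_mod_cast ha, by exact_mod_cast hb, hab',
        (associatedMeasure_affine ⟨τ₁, h₁⟩ ⟨τ₂, h₂⟩ τ a b hab' heq.symm).symm⟩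
    exact congrArg Subtype.val (hinj this)

theorem tracesAreInvariantMeasures (hfree : EssentiallyFree G) (hν : ν.DominatesReduced) :
    TracesAreInvariantMeasures ν := by
  refine ⟨convex_tracialStates _, convex_invariantMeasures G, traceHomeomorph hfree hν,
    fun τ μ => ⟨fun h => h.unique (isAssociatedMeasure_associatedMeasure τ), ?_⟩,
    associatedMeasure_affine, mem_extremePoints_iff_associatedMeasure hfree hν⟩
  rintro rfl
  exact isAssociatedMeasure_associatedMeasure τ

end Homeomorphism

end GroupoidStructure

theorem mainTheorem7 {G : Type u} [GroupoidStructure G] [TopologicalSpace G] [T2Space G]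
    [LocallyCompactSpace G] [EtaleGroupoid G] [CompactSpace (UnitSpace G)]
    [MeasurableSpace G] [BorelSpace G] (hfree : EssentiallyFree G) :
    (∀ ν : CStarNorm G, ν.DominatesReduced → TracesAreInvariantMeasures ν) ∧
    (∃ ν : CStarNorm G, (∀ f, ν f = reducedNorm f) ∧ TracesAreInvariantMeasures ν) ∧
    (∃ ν : CStarNorm G, (∀ f, ν f = maximalNorm f) ∧ TracesAreInvariantMeasures ν) :=
  ⟨fun _ hν => tracesAreInvariantMeasures hfree hν,
    ⟨reducedCStarNorm G, reducedCStarNorm_apply,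
      tracesAreInvariantMeasures hfree dominatesReduced_reducedCStarNorm⟩,
    ⟨maximalCStarNorm G, maximalCStarNorm_apply,
      tracesAreInvariantMeasures hfree dominatesReduced_maximalCStarNorm⟩⟩
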